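/- Let $d\in\mathbb{N}$ and regard $\mathbb{Z}^d$ as the graph in which two vertices are adjacent if their Euclidean distance is $1$. Let $\Gamma$ be either the group of all translations of $\mathbb{Z}^d$ or the group of all graph automorphisms of $\mathbb{Z}^d$. Let $\mathcal{A}$ be a finite set and $\Lambda:\mathbb{Z}^d\to\mathcal{A}$ a map (a colouring). A pattern is a map $P:Q(P)\to\mathcal{A}$ on a finite set $Q(P)\subset\mathbb{Z}^d$. For $\gamma\in\Gamma$ the pattern $\gamma P:\gamma Q(P)\to\mathcal{A}$ is defined by $\gamma P(\gamma y)=P(y)$, and $P\sim P'$ means that $\gamma P=P'$ for some $\gamma\in\Gamma$. For finite $Q$, $\Lambda\cap Q$ and $P\cap Q$ (if $Q\subset Q(P)$) denote the restrictions of $\Lambda$ and $P$ to $Q$. Let $\sharp_P P'$ be the number of $x\in Q(P')$ with $x+Q(P)\subset Q(P')$ and $P'\cap(x+Q(P))\sim P$. Let $(Q_j)_{j\in\mathbb{N}}$ be a van Hove sequence, i.e. a sequence of finite subsets of $\mathbb{Z}^d$, nonempty for all large $j$, such that $|\partial Q_j|/|Q_j|\to 0$, where $\partial Q$ is the set of all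 vertices of $Q$ that have a neighbour outside $Q$. Assume that for every $M\in\mathbb{N}$ and every pattern $P$ with $Q(P)=\{x\in\mathbb{Z}^d:0\le x_i\le M-1,\ i=1,\dots,d\}$ the frequency $\nu_P=\lim_{j\to\infty}|Q_j|^{-1}\,\sharp_P(\Lambda\cap Q_j)$ exists. Let $\mathcal{H}$ be a Hilbert space with $1\le\dim\mathcal{H}<\infty$ and let $H$ be an everywhere defined selfadjoint operator on $\ell^2(\mathbb{Z}^d,\mathcal{H})$. Write $p_x u=u(x)$ and let $i_x$ be the adjoint of $p_x$; for finite $Q\subset\mathbb{Z}^d$ let $p_Q$ be the orthogonal projection onto the subspace $\ell^2(Q,\mathcal{H})$ of the elements supported in $Q$, and $i_Q$ its adjoint, the inclusion. Assume that * (finite range) there is $R>0$ with $p_yHi_x=0$ whenever the distance of $x,y\in\mathbb{Z}^d$ is bigger than $R$; * ($\Lambda$-invariance) there is $R\in\mathbb{N}$ such that, with $C_R(x)=\{z\in\mathbb{Z}^d:\max_i|z_i-x_i|\le R\}$, one has $p_yHi_x=p_{\gamma y}Hi_{\gamma x}$ for all $x,y\in\mathbb{Z}^d$ and $\gamma\in\Gamma$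 with $\gamma\bigl(\Lambda\cap(C_R(x)\cup C_R(y))\bigr)=\Lambda\cap\bigl(C_R(\gamma x)\cup C_R(\gamma y)\bigr)$. For a selfadjoint operator $B$ on a finite-dimensional Hilbert space and $\lambda\in\mathbb{R}$ let $n(B)(\lambda)$ be the number of eigenvalues of $B$ not exceeding $\lambda$, counted with multiplicity. Then there exists a unique probability measure $\mu_H$ on $\mathbb{R}$ such that, with its distribution function $N_H(\lambda)=\mu_H((-\infty,\lambda])$, $$\lim_{j\to\infty}\ \sup_{\lambda\in\mathbb{R}}\left|\frac{n(p_{Q_j}Hi_{Q_j})(\lambda)}{|Q_j|\,\dim\mathcal{H}}-N_H(\lambda)\right|=0 .$$ -/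

import Mathlib

open Filter Topology MeasureTheory

namespace LatticeIDS

noncomputable section

/-! ### The lattice graph and its symmetry groups -/

/-- The vertex set `ℤ^d`. -/
abbrev Site (d : ℕ) : Type := Fin d → ℤ

/-- Two vertices of `ℤ^d` are adjacent if their Euclidean distance is `1`. -/
def Adjacent {d : ℕ} (x y : Site d) : Prop := ∑ i, (x i - y i) ^ 2 = 1

/-- The group of translations of `ℤ^d`. -/
def translationGroup (d : ℕ) : Subgroup (Equiv.Perm (Site d)) where
  carrier := {γ | ∃ t : Site d, ∀ x, γ x = t + x}
  mul_mem' := by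
    rintro a b ⟨s, hs⟩ ⟨t, ht⟩
    exact ⟨s + t, fun x => by rw [Equiv.Perm.mul_apply, ht, hs, add_assoc]⟩
  one_mem' := ⟨0, fun x => by simp⟩
  inv_mem' := by
    rintro a ⟨s, hs⟩
    exact ⟨-s, fun x => by rw [Equiv.Perm.inv_eq_iff_eq, hs]; simp⟩

/-- The group of all graph automorphisms of `ℤ^d`. -/
def automorphismGroup (d : ℕ) : Subgroup (Equiv.Perm (Site d)) where
  carrier := {γ | ∀ x y, Adjacent (γ x) (γ y) ↔ Adjacent x y}
  mul_mem' := by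
    intro a b ha hb x y
    rw [Equiv.Perm.mul_apply, Equiv.Perm.mul_apply, ha, hb]
  one_mem' := fun x y => by simp
  inv_mem' := by
    intro a ha x y
    rw [← ha (a⁻¹ x) (a⁻¹ y)]
    simp

open Classical in
/-- The inner vertex boundary: the vertices of `Q` with a neighbour outside `Q`. -/
def innerBoundary {d : ℕ} (Q : Finset (Site d)) : Finset (Site d) :=
  Q.filter fun x => ∃ y, Adjacent x y ∧ y ∉ Q

/-- A van Hove sequence: finite sets, nonempty from some index on (so that the quotient makes
sense), with `|∂Q_l| / |Q_l| → 0`. -/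
def IsVanHove {d : ℕ} (Q : ℕ → Finset (Site d)) : Prop :=
  (∀ᶠ l in atTop, (Q l).Nonempty) ∧
    Tendsto (fun l => ((innerBoundary (Q l)).card : ℝ) / ((Q l).card : ℝ)) atTop (𝓝 0)

/-! ### Patterns and their frequencies -/

/-- A pattern: a map from a finite subset of `ℤ^d` to the set of colours. -/
structure Pattern (d : ℕ) (A : Type*) where
  dom : Finset (Site d)
  col : dom → A

/-- The restriction `Λ ∩ Q` of a colouring `Λ` to a finite set `Q`. -/
def colouringRestrict {d : ℕ} {A : Type*} (Λ : Site d → A) (Q : Finset (Site d)) :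
    Pattern d A where
  dom := Q
  col x := Λ x

/-- The restriction `P ∩ Q` of a pattern `P` to a subset `Q` of its domain. -/
def Pattern.restrict {d : ℕ} {A : Type*} (P : Pattern d A) (Q : Finset (Site d))
    (h : Q ⊆ P.dom) : Pattern d A where
  dom := Q
  col x := P.col ⟨x, h x.2⟩

/-- The shifted pattern `γP : γ Q(P) → A`, `γ y ↦ P y`. -/
def Pattern.shift {d : ℕ} {A : Type*} (γ : Equiv.Perm (Site d)) (P : Pattern d A) :
    Pattern d A where
  dom := P.dom.map γ.toEmbedding
  col z := P.col ⟨γ.symm z, by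
    obtain ⟨y, hy, hyz⟩ := Finset.mem_map.1 z.2
    rw [← hyz]
    simpa using hy⟩

/-- Equivalence of patterns: `γP = P'` for some `γ ∈ Γ`. -/
def Pattern.Equivalent {d : ℕ} {A : Type*} (Γ : Subgroup (Equiv.Perm (Site d)))
    (P P' : Pattern d A) : Prop :=
  ∃ γ ∈ Γ, P.shift γ = P'

/-- The cube `C_M = {x : 0 ≤ x_j ≤ M - 1}`. -/
def cube (d M : ℕ) : Finset (Site d) := Finset.Icc 0 (fun _ => (M : ℤ) - 1)

/-- The translate `x + Q`. -/
def translate {d : ℕ} (x : Site d) (Q : Finset (Site d)) : Finset (Site d) :=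
  Q.map (Equiv.addLeft x).toEmbedding

/-- The number of `x ∈ Q(P')` such that `x + Q(P) ⊆ Q(P')` and `P' ∩ (x + Q(P))` is equivalent
to `P`. -/
def occurrences {d : ℕ} {A : Type*} (Γ : Subgroup (Equiv.Perm (Site d)))
    (P P' : Pattern d A) : ℕ :=
  Set.ncard {x : Site d | x ∈ P'.dom ∧
    ∃ h : translate x P.dom ⊆ P'.dom, (P'.restrict (translate x P.dom) h).Equivalent Γ P}

/-- All frequencies `ν_P = lim_j |Q_j|⁻¹ ♯_P (Λ ∩ Q_j)`, for `P` a cube pattern, exist. -/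
def FrequenciesExist {d : ℕ} {A : Type*} (Γ : Subgroup (Equiv.Perm (Site d)))
    (Λ : Site d → A) (Q : ℕ → Finset (Site d)) : Prop :=
  ∀ (M : ℕ) (P : Pattern d A), P.dom = cube d M →
    ∃ ν : ℝ, Tendsto
      (fun j => (occurrences Γ P (colouringRestrict Λ (Q j)) : ℝ) / ((Q j).card : ℝ))
      atTop (𝓝 ν)

/-! ### Operators on `ℓ²(ℤ^d, 𝓗)` -/

section Operators

variable {𝕜 : Type*} [RCLike 𝕜] {d : ℕ} {A : Type*}
variable {E : Type*} [NormedAddCommGroup E] [InnerProductSpace 𝕜 E]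

/-- The Hilbert space `ℓ²(ℤ^d, E)`. -/
abbrev L2 (d : ℕ) (E : Type*) [NormedAddCommGroup E] : Type _ := lp (fun _ : Site d => E) 2

/-- The block `p_y H i_x : E → E`, where `p_y u = u y` and `i_x`, the adjoint of `p_x`, puts a
vector at the site `x`. -/
def block (H : L2 d E →ₗ[𝕜] L2 d E) (y x : Site d) : E →ₗ[𝕜] E where
  toFun v := H (lp.single 2 x v) y
  map_add' v w := by simp [lp.single_add]
  map_smul' c v := by simp [lp.single_smul]

/-- Finite range: `p_y H i_x = 0` whenever `x` and `y` are further apart than some `R > 0`.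
(`dist` is the maximum metric on `ℤ^d`; any two of the usual metrics give the same notion.) -/
def FiniteRange (H : L2 d E →ₗ[𝕜] L2 d E) : Prop :=
  ∃ R : ℝ, 0 < R ∧ ∀ x y : Site d, R < dist x y → block H y x = 0

/-- The cube `C_R(x)` of radius `R` centred at `x`. -/
def cubeAt (R : ℕ) (x : Site d) : Finset (Site d) :=
  Finset.Icc (fun i => x i - (R : ℤ)) (fun i => x i + (R : ℤ))

/-- `Λ`-invariance with respect to `Γ`: for some `R`, `p_y H i_x = p_{γy} H i_{γx}` whenever
`γ ∈ Γ` maps the pattern `Λ ∩ (C_R(x) ∪ C_R(y))` to `Λ ∩ (C_R(γx) ∪ C_R(γy))`. -/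
def ColouringInvariant (Γ : Subgroup (Equiv.Perm (Site d))) (Λ : Site d → A)
    (H : L2 d E →ₗ[𝕜] L2 d E) : Prop :=
  ∃ R : ℕ, ∀ x y : Site d, ∀ γ ∈ Γ,
    (colouringRestrict Λ (cubeAt R x ∪ cubeAt R y)).shift γ =
        colouringRestrict Λ (cubeAt R (γ x) ∪ cubeAt R (γ y)) →
      block H y x = block H (γ y) (γ x)

variable (𝕜 E) in
/-- `ℓ²(Q, E)`: the subspace of the elements of `ℓ²(ℤ^d, E)` supported in `Q`. -/
def supportedIn (Q : Finset (Site d)) : Submodule 𝕜 (L2 d E) where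
  carrier := {u | ∀ x, x ∉ Q → u x = 0}
  add_mem' := by
    intro u v hu hv x hx
    simp [hu x hx, hv x hx]
  zero_mem' := fun x _ => by simp
  smul_mem' := by
    intro c u hu x hx
    simp [hu x hx]

/-- The projection `p_Q` of `ℓ²(ℤ^d, E)` onto `ℓ²(Q, E)`: it keeps the values on `Q`. -/
def proj (Q : Finset (Site d)) : L2 d E →ₗ[𝕜] supportedIn 𝕜 E Q where
  toFun u := ⟨∑ x ∈ Q, lp.single 2 x (u x), fun y hy => by
    simp only [lp.coeFn_sum, Finset.sum_apply, lp.coeFn_single, Finset.sum_pi_single, if_neg hy]⟩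
  map_add' u v := by
    ext1
    simp [lp.single_add, Finset.sum_add_distrib]
  map_smul' c u := by
    ext1
    simp [lp.single_smul, Finset.smul_sum]

/-- `p_Q` is the adjoint of the inclusion `i_Q`. -/
theorem inner_proj (Q : Finset (Site d)) (u : L2 d E) (v : supportedIn 𝕜 E Q) :
    inner 𝕜 (proj Q u) v = inner 𝕜 u (v : L2 d E) := by
  have h : (v : L2 d E) = ∑ x ∈ Q, lp.single 2 x ((v : L2 d E) x) := by
    ext y
    simp only [lp.coeFn_sum, Finset.sum_apply, lp.coeFn_single, Finset.sum_pi_single]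
    split_ifs with hy
    · rfl
    · exact v.2 y hy
  have h2 : inner 𝕜 (proj Q u) v
      = inner 𝕜 (∑ x ∈ Q, lp.single 2 x (u x) : L2 d E) (v : L2 d E) := rfl
  rw [h2, sum_inner]
  conv_rhs => rw [h, inner_sum]
  exact Finset.sum_congr rfl fun x _ => by
    rw [lp.inner_single_left, lp.inner_single_right]

/-- The restriction `p_Q H i_Q` of `H` to `ℓ²(Q, E)`. -/
def compress (H : L2 d E →ₗ[𝕜] L2 d E) (Q : Finset (Site d)) :
    supportedIn 𝕜 E Q →ₗ[𝕜] supportedIn 𝕜 E Q :=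
  proj Q ∘ₗ H ∘ₗ (supportedIn 𝕜 E Q).subtype

theorem compress_isSymmetric {H : L2 d E →ₗ[𝕜] L2 d E} (hH : H.IsSymmetric)
    (Q : Finset (Site d)) : (compress H Q).IsSymmetric := by
  intro u v
  have h1 : inner 𝕜 (compress H Q u) v = inner 𝕜 (H (u : L2 d E)) (v : L2 d E) :=
    inner_proj Q _ v
  have h2 : inner 𝕜 (compress H Q v) u = inner 𝕜 (H (v : L2 d E)) (u : L2 d E) :=
    inner_proj Q _ u
  rw [h1, hH, ← inner_conj_symm u (compress H Q v), h2, inner_conj_symm]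

instance supportedIn_finiteDimensional [FiniteDimensional 𝕜 E] (Q : Finset (Site d)) :
    FiniteDimensional 𝕜 (supportedIn 𝕜 E Q) := by
  let f : supportedIn 𝕜 E Q →ₗ[𝕜] (Q → E) :=
    { toFun := fun u x => (u : L2 d E) x
      map_add' := fun u v => by ext x; simp
      map_smul' := fun c u => by ext x; simp }
  refine FiniteDimensional.of_injective f fun u v huv => ?_
  ext x
  by_cases hx : x ∈ Q
  · exact congrFun huv ⟨x, hx⟩
  · rw [u.2 x hx, v.2 x hx]

end Operators

/-- The cumulative eigenvalue counting function: the number of eigenvalues, counted with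
multiplicity, of a selfadjoint operator on a finite-dimensional Hilbert space that do not
exceed `t`. -/
def eigenvalueCount {𝕜 : Type*} [RCLike 𝕜] {V : Type*} [NormedAddCommGroup V]
    [InnerProductSpace 𝕜 V] [FiniteDimensional 𝕜 V] {T : V →ₗ[𝕜] V} (hT : T.IsSymmetric)
    (t : ℝ) : ℕ :=
  (Finset.univ.filter fun i : Fin (Module.finrank 𝕜 V) => hT.eigenvalues rfl i ≤ t).card

end

end LatticeIDS

/-! The eigenvalue count of `compress H Q` is almost additive in `Q`, with errors independent of
`t`. Min-max, in the form of dimension counts for test subspaces, gives three facts. Deleting sites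
lowers the count by at most `finrank 𝕜 E` per site (`eigenvalueCount_compress_mono`,
`eigenvalueCount_compress_add_le`). Counts add over pieces not coupled by `H`
(`eigenvalueCount_compress_biUnion`). A permutation of sites that preserves the blocks preserves the
count (`eigenvalueCount_compress_map`).

Tile `Q` by cubes of side `M` and shrink each to its interior of radius `R`, where `R` dominates
both the range and the invariance radius. The cubes decouple, and each count depends only on the
class of the pattern in its cube. Relative to `|Q|`, the loss is a boundary ratio plus `1 - ((M -
2R)/M)^d`. Averaging over all `M^d` positions of the grid yields a sum over all cubes inside `Q`,
that is, over finitely many pattern classes weighted by their occurrence numbers. These have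
frequencies, so the normalized counts are uniformly Cauchy, and a uniform limit of distribution
functions is again one.

When `Γ` is the full automorphism group, one also needs that graph automorphisms map maximum-norm
cubes to such cubes (`map_cubeAt`). -/

namespace LatticeIDS

/-! ### Eigenvalue counts as dimensions of test subspaces -/

section Variational

variable {𝕜 : Type*} [RCLike 𝕜]
variable {V : Type*} [NormedAddCommGroup V] [InnerProductSpace 𝕜 V] [FiniteDimensional 𝕜 V]

theorem re_inner_eq_sum_eigenvalues {T : V →ₗ[𝕜] V} (hT : T.IsSymmetric) (v : V) :
    RCLike.re (inner 𝕜 (T v) v) =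
      ∑ i, hT.eigenvalues rfl i * ‖inner 𝕜 (hT.eigenvectorBasis rfl i) v‖ ^ 2 := by
  rw [← (hT.eigenvectorBasis rfl).sum_inner_mul_inner, map_sum]
  refine Finset.sum_congr rfl fun i _ => ?_
  rw [hT, hT.apply_eigenvectorBasis, inner_smul_right, mul_assoc, ← inner_conj_symm v,
    RCLike.conj_mul, ← RCLike.ofReal_pow, ← RCLike.ofReal_mul, RCLike.ofReal_re]

omit [FiniteDimensional 𝕜 V] in
/-- The span of the members of an orthonormal basis that satisfy `p`. -/
theorem exists_submodule_of_orthonormalBasis {ι : Type*} [Fintype ι]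
    (b : OrthonormalBasis ι 𝕜 V) (p : ι → Prop) [DecidablePred p] :
    ∃ W : Submodule 𝕜 V, Module.finrank 𝕜 W = (Finset.univ.filter p).card ∧
      ∀ v ∈ W, ∀ i, ¬ p i → inner 𝕜 (b i) v = 0 := by
  classical
  refine ⟨Submodule.span 𝕜 (Set.range fun i : {i // p i} => b i), ?_, fun v hv i hi => ?_⟩
  · rw [finrank_span_eq_card, Fintype.card_subtype]
    exact b.orthonormal.linearIndependent.comp _ Subtype.val_injective
  · induction hv using Submodule.span_induction with
    | mem x hx =>
      obtain ⟨j, rfl⟩ := hx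
      exact b.orthonormal.2 fun h => hi (h ▸ j.2)
    | zero => simp
    | add x y _ _ hx hy => rw [inner_add_right, hx, hy, add_zero]
    | smul c x _ hx => rw [inner_smul_right, hx, mul_zero]

/-- Take the span of the eigenvectors with eigenvalue at most `t`. Together with the complementary
span in the next lemma, this is all of min-max that is needed. -/
theorem exists_submodule_re_inner_le {T : V →ₗ[𝕜] V} (hT : T.IsSymmetric) (t : ℝ) :
    ∃ W : Submodule 𝕜 V, Module.finrank 𝕜 W = eigenvalueCount hT t ∧
      ∀ v ∈ W, RCLike.re (inner 𝕜 (T v) v) ≤ t * ‖v‖ ^ 2 := by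
  obtain ⟨W, hW, h⟩ := exists_submodule_of_orthonormalBasis (hT.eigenvectorBasis rfl)
    (fun i => hT.eigenvalues rfl i ≤ t)
  refine ⟨W, hW, fun v hv => ?_⟩
  rw [re_inner_eq_sum_eigenvalues hT, ← (hT.eigenvectorBasis rfl).sum_sq_norm_inner_right,
    Finset.mul_sum]
  refine Finset.sum_le_sum fun i _ => ?_
  by_cases hi : hT.eigenvalues rfl i ≤ t
  · gcongr
  · simp [h v hv i hi]

theorem exists_submodule_lt_re_inner {T : V →ₗ[𝕜] V} (hT : T.IsSymmetric) (t : ℝ) :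
    ∃ W : Submodule 𝕜 V,
      Module.finrank 𝕜 W + eigenvalueCount hT t = Module.finrank 𝕜 V ∧
      ∀ v ∈ W, v ≠ 0 → t * ‖v‖ ^ 2 < RCLike.re (inner 𝕜 (T v) v) := by
  obtain ⟨W, hW, h⟩ := exists_submodule_of_orthonormalBasis (hT.eigenvectorBasis rfl)
    (fun i => ¬ hT.eigenvalues rfl i ≤ t)
  refine ⟨W, ?_, fun v hv hv0 => ?_⟩
  · rw [hW, eigenvalueCount, add_comm, Finset.card_filter_add_card_filter_not, Finset.card_univ,
      Fintype.card_fin]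
  rw [re_inner_eq_sum_eigenvalues hT, ← (hT.eigenvectorBasis rfl).sum_sq_norm_inner_right,
    Finset.mul_sum]
  have key : ∀ i, inner 𝕜 (hT.eigenvectorBasis rfl i) v ≠ 0 → t < hT.eigenvalues rfl i :=
    fun i hi => not_le.1 fun hle => hi (h v hv i (not_not.2 hle))
  obtain ⟨i, hi⟩ : ∃ i, inner 𝕜 (hT.eigenvectorBasis rfl i) v ≠ 0 := by
    by_contra! hcon
    apply hv0
    rw [← norm_eq_zero, ← sq_eq_zero_iff, ← (hT.eigenvectorBasis rfl).sum_sq_norm_inner_right]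
    simp [hcon]
  refine Finset.sum_lt_sum (fun j _ => ?_) ⟨i, Finset.mem_univ i, ?_⟩
  · by_cases hj : inner 𝕜 (hT.eigenvectorBasis rfl j) v = 0
    · simp [hj]
    · exact mul_le_mul_of_nonneg_right (key j hj).le (by positivity)
  · exact mul_lt_mul_of_pos_right (key i hi) (by positivity)

theorem eigenvalueCount_mono {T : V →ₗ[𝕜] V} (hT : T.IsSymmetric) :
    Monotone (eigenvalueCount hT) := fun _ _ hst =>
  Finset.card_le_card fun _ hi => by
    rw [Finset.mem_filter] at hi ⊢
    exact ⟨hi.1, hi.2.trans hst⟩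

theorem eigenvalueCount_le_finrank {T : V →ₗ[𝕜] V} (hT : T.IsSymmetric) (t : ℝ) :
    eigenvalueCount hT t ≤ Module.finrank 𝕜 V :=
  (Finset.card_filter_le _ _).trans (by simp)

theorem eventually_eigenvalueCount_eq_zero {T : V →ₗ[𝕜] V} (hT : T.IsSymmetric) :
    ∀ᶠ t in atBot, eigenvalueCount hT t = 0 := by
  have : ∀ᶠ t in atBot, ∀ i, t < hT.eigenvalues rfl i :=
    eventually_all.2 fun i => eventually_lt_atBot _
  filter_upwards [this] with t ht
  rw [eigenvalueCount, Finset.card_eq_zero, Finset.filter_eq_empty_iff]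
  exact fun i _ => not_le.2 (ht i)

theorem eventually_eigenvalueCount_eq_finrank {T : V →ₗ[𝕜] V} (hT : T.IsSymmetric) :
    ∀ᶠ t in atTop, eigenvalueCount hT t = Module.finrank 𝕜 V := by
  have : ∀ᶠ t in atTop, ∀ i, hT.eigenvalues rfl i ≤ t :=
    eventually_all.2 fun i => eventually_ge_atTop _
  filter_upwards [this] with t ht
  rw [eigenvalueCount, Finset.filter_true_of_mem fun i _ => ht i, Finset.card_univ,
    Fintype.card_fin]

/-- Right continuity: there are finitely many eigenvalues, so none lies just above `t`, and those
equal to `t` are already counted. -/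
theorem eventually_eigenvalueCount_eq {T : V →ₗ[𝕜] V} (hT : T.IsSymmetric) (t : ℝ) :
    ∀ᶠ s in 𝓝[≥] t, eigenvalueCount hT s = eigenvalueCount hT t := by
  have : ∀ᶠ s in 𝓝[≥] t, ∀ i, hT.eigenvalues rfl i ≤ s ↔ hT.eigenvalues rfl i ≤ t := by
    refine eventually_all.2 fun i => ?_
    by_cases hi : hT.eigenvalues rfl i ≤ t
    · filter_upwards [self_mem_nhdsWithin] with s hs
      exact ⟨fun _ => hi, fun h => h.trans hs⟩
    · filter_upwards [nhdsWithin_le_nhds (Iio_mem_nhds (not_le.1 hi))] with s hs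
      exact ⟨fun h => absurd h (not_le.2 hs), fun h => absurd h hi⟩
  filter_upwards [this] with s hs
  simp only [eigenvalueCount, hs]

end Variational

/-! ### Comparing compressions to different sets of sites -/

section Lattice

variable {𝕜 : Type*} [RCLike 𝕜] {d : ℕ}
variable {E : Type*} [NormedAddCommGroup E] [InnerProductSpace 𝕜 E]

theorem inner_compress (H : L2 d E →ₗ[𝕜] L2 d E) (Q : Finset (Site d))
    (u v : supportedIn 𝕜 E Q) :
    inner 𝕜 (compress H Q u) v = inner 𝕜 (H (u : L2 d E)) (v : L2 d E) :=
  inner_proj Q _ v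

theorem eq_sum_single_of_mem_supportedIn {Q : Finset (Site d)} {u : L2 d E}
    (hu : u ∈ supportedIn 𝕜 E Q) : u = ∑ x ∈ Q, lp.single 2 x (u x) := by
  ext y
  simp only [lp.coeFn_sum, Finset.sum_apply, lp.coeFn_single, Finset.sum_pi_single]
  split_ifs with hy
  · rfl
  · exact hu y hy

theorem inner_eq_sum_of_mem_supportedIn {Q : Finset (Site d)} (w : L2 d E) {v : L2 d E}
    (hv : v ∈ supportedIn 𝕜 E Q) : inner 𝕜 w v = ∑ y ∈ Q, inner 𝕜 (w y) (v y) := by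
  conv_lhs => rw [eq_sum_single_of_mem_supportedIn hv, inner_sum]
  exact Finset.sum_congr rfl fun y _ => lp.inner_single_right _ _ _

theorem apply_eq_sum_block (H : L2 d E →ₗ[𝕜] L2 d E) {Q : Finset (Site d)} {u : L2 d E}
    (hu : u ∈ supportedIn 𝕜 E Q) (y : Site d) : H u y = ∑ x ∈ Q, block H y x (u x) := by
  conv_lhs => rw [eq_sum_single_of_mem_supportedIn hu, map_sum]
  simp only [lp.coeFn_sum, Finset.sum_apply]
  rfl

theorem supportedIn_mono {Q Q' : Finset (Site d)} (h : Q ⊆ Q') :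
    supportedIn 𝕜 E Q ≤ supportedIn 𝕜 E Q' := fun _ hu x hx => hu x fun hxQ => hx (h hxQ)

theorem disjoint_supportedIn {Q Q' : Finset (Site d)} (h : Disjoint Q Q') :
    Disjoint (supportedIn 𝕜 E Q) (supportedIn 𝕜 E Q') := by
  rw [Submodule.disjoint_def]
  intro u hu hu'
  ext x
  by_cases hx : x ∈ Q
  · exact hu' x (Finset.disjoint_left.1 h hx)
  · exact hu x hx

variable (𝕜) in
/-- The vector `u` on `Q`, moved along a permutation of the sites. -/
noncomputable def relabel (γ : Equiv.Perm (Site d)) (Q : Finset (Site d)) :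
    L2 d E →ₗ[𝕜] L2 d E where
  toFun u := ∑ x ∈ Q, lp.single 2 (γ x) (u x)
  map_add' u v := by simp [lp.single_add, Finset.sum_add_distrib]
  map_smul' c u := by simp [lp.single_smul, Finset.smul_sum]

theorem relabel_apply (γ : Equiv.Perm (Site d)) {Q : Finset (Site d)} {u : L2 d E}
    (hu : u ∈ supportedIn 𝕜 E Q) (x : Site d) : relabel 𝕜 γ Q u (γ x) = u x := by
  have : relabel 𝕜 γ Q u = ∑ x ∈ Q, lp.single 2 (γ x) (u x) := rfl
  rw [this]
  simp only [lp.coeFn_sum, Finset.sum_apply, lp.coeFn_single, Pi.single_apply,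
    EmbeddingLike.apply_eq_iff_eq, Finset.sum_ite_eq]
  split_ifs with hx
  · rfl
  · exact (hu x hx).symm

theorem relabel_mem (γ : Equiv.Perm (Site d)) {Q : Finset (Site d)} {u : L2 d E}
    (hu : u ∈ supportedIn 𝕜 E Q) :
    relabel 𝕜 γ Q u ∈ supportedIn 𝕜 E (Q.map γ.toEmbedding) := by
  intro y hy
  obtain ⟨x, rfl⟩ := γ.surjective y
  rw [relabel_apply γ hu]
  exact hu x fun hx => hy (Finset.mem_map_of_mem _ hx)

variable [FiniteDimensional 𝕜 E]

theorem finrank_supportedIn (Q : Finset (Site d)) :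
    Module.finrank 𝕜 (supportedIn 𝕜 E Q) = Q.card * Module.finrank 𝕜 E := by
  let e : supportedIn 𝕜 E Q ≃ₗ[𝕜] (Q → E) :=
    { toFun := fun u x => (u : L2 d E) x
      map_add' := fun u v => by ext x; simp
      map_smul' := fun c u => by ext x; simp
      invFun := fun f => ⟨∑ x : Q, lp.single 2 (x : Site d) (f x), fun y hy => by
        simp only [lp.coeFn_sum, Finset.sum_apply, lp.coeFn_single]
        refine Finset.sum_eq_zero fun x _ => Pi.single_eq_of_ne ?_ _
        rintro rfl
        exact hy x.2⟩
      left_inv := fun u => by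
        ext1
        conv_rhs => rw [eq_sum_single_of_mem_supportedIn u.2, ← Finset.sum_coe_sort]
      right_inv := fun f => by
        ext x
        change (∑ y : Q, lp.single 2 (y : Site d) (f y) : L2 d E) x = f x
        rw [lp.coeFn_sum, Finset.sum_apply, Finset.sum_eq_single x]
        · exact lp.single_apply_self _ _ _
        · exact fun y _ hy => lp.single_apply_ne _ _ _ fun h => hy (Subtype.ext h.symm)
        · exact fun h => absurd (Finset.mem_univ x) h }
  rw [e.finrank_eq, Module.finrank_pi_fintype]
  simp

variable {H : L2 d E →ₗ[𝕜] L2 d E} (hH : H.IsSymmetric)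
include hH

/-- The test subspace is placed in the ambient `ℓ²` space and tested with the form of `H` itself, so
that subspaces belonging to different `Q` can be compared. -/
theorem exists_le_supportedIn_re_inner_le (Q : Finset (Site d)) (t : ℝ) :
    ∃ W ≤ supportedIn 𝕜 E Q,
      Module.finrank 𝕜 W = eigenvalueCount (compress_isSymmetric hH Q) t ∧
      ∀ u ∈ W, RCLike.re (inner 𝕜 (H u) u) ≤ t * ‖u‖ ^ 2 := by
  obtain ⟨W, hW, h⟩ := exists_submodule_re_inner_le (compress_isSymmetric hH Q) t
  refine ⟨W.map (supportedIn 𝕜 E Q).subtype, Submodule.map_subtype_le _ _, ?_, ?_⟩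
  · rw [← hW, Submodule.finrank_map_subtype_eq]
  · rintro _ ⟨u, hu, rfl⟩
    have := h u hu
    rwa [inner_compress] at this

theorem exists_le_supportedIn_lt_re_inner (Q : Finset (Site d)) (t : ℝ) :
    ∃ W ≤ supportedIn 𝕜 E Q,
      Module.finrank 𝕜 W + eigenvalueCount (compress_isSymmetric hH Q) t =
        Q.card * Module.finrank 𝕜 E ∧
      ∀ u ∈ W, u ≠ 0 → t * ‖u‖ ^ 2 < RCLike.re (inner 𝕜 (H u) u) := by
  obtain ⟨W, hW, h⟩ := exists_submodule_lt_re_inner (compress_isSymmetric hH Q) t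
  refine ⟨W.map (supportedIn 𝕜 E Q).subtype, Submodule.map_subtype_le _ _, ?_, ?_⟩
  · rw [← finrank_supportedIn, ← hW, Submodule.finrank_map_subtype_eq]
  · rintro _ ⟨u, hu, rfl⟩ hu0
    have := h u hu fun h0 => hu0 (by simp [h0])
    rwa [inner_compress] at this

omit hH in
-- A common nonzero vector would satisfy both opposite inequalities, so the two subspaces are
-- independent inside `supportedIn 𝕜 E Q`.
theorem finrank_add_finrank_le_of_re_inner {Q : Finset (Site d)} {t : ℝ}
    {W U : Submodule 𝕜 (L2 d E)} (hW : W ≤ supportedIn 𝕜 E Q) (hU : U ≤ supportedIn 𝕜 E Q)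
    (hWt : ∀ u ∈ W, RCLike.re (inner 𝕜 (H u) u) ≤ t * ‖u‖ ^ 2)
    (hUt : ∀ u ∈ U, u ≠ 0 → t * ‖u‖ ^ 2 < RCLike.re (inner 𝕜 (H u) u)) :
    Module.finrank 𝕜 W + Module.finrank 𝕜 U ≤ Q.card * Module.finrank 𝕜 E := by
  have := Submodule.finiteDimensional_of_le hW
  have := Submodule.finiteDimensional_of_le hU
  have hdisj : W ⊓ U = ⊥ := by
    rw [Submodule.eq_bot_iff]
    intro u hu
    by_contra hu0
    exact absurd (hUt u hu.2 hu0) (not_lt.2 (hWt u hu.1))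
  have h := Submodule.finrank_sup_add_finrank_inf_eq W U
  rw [hdisj, finrank_bot, add_zero] at h
  rw [← h, ← finrank_supportedIn]
  exact Submodule.finrank_mono (sup_le hW hU)

theorem finrank_le_eigenvalueCount {Q : Finset (Site d)} {t : ℝ}
    {W : Submodule 𝕜 (L2 d E)} (hW : W ≤ supportedIn 𝕜 E Q)
    (hWt : ∀ u ∈ W, RCLike.re (inner 𝕜 (H u) u) ≤ t * ‖u‖ ^ 2) :
    Module.finrank 𝕜 W ≤ eigenvalueCount (compress_isSymmetric hH Q) t := by
  obtain ⟨U, hU, hdim, hUt⟩ := exists_le_supportedIn_lt_re_inner hH Q t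
  have := finrank_add_finrank_le_of_re_inner hW hU hWt hUt
  omega

theorem finrank_add_eigenvalueCount_le {Q : Finset (Site d)} {t : ℝ}
    {U : Submodule 𝕜 (L2 d E)} (hU : U ≤ supportedIn 𝕜 E Q)
    (hUt : ∀ u ∈ U, u ≠ 0 → t * ‖u‖ ^ 2 < RCLike.re (inner 𝕜 (H u) u)) :
    Module.finrank 𝕜 U + eigenvalueCount (compress_isSymmetric hH Q) t ≤
      Q.card * Module.finrank 𝕜 E := by
  obtain ⟨W, hW, hdim, hWt⟩ := exists_le_supportedIn_re_inner_le hH Q t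
  have := finrank_add_finrank_le_of_re_inner hW hU hWt hUt
  omega

theorem eigenvalueCount_compress_mono {Q Q' : Finset (Site d)} (h : Q' ⊆ Q) (t : ℝ) :
    eigenvalueCount (compress_isSymmetric hH Q') t ≤
      eigenvalueCount (compress_isSymmetric hH Q) t := by
  obtain ⟨W, hW, hdim, hWt⟩ := exists_le_supportedIn_re_inner_le hH Q' t
  rw [← hdim]
  exact finrank_le_eigenvalueCount hH (hW.trans (supportedIn_mono h)) hWt

/-- A subspace where the form exceeds `t` for `Q'` still serves for `Q`; hence each added site
contributes at most `finrank 𝕜 E` eigenvalues. -/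
theorem eigenvalueCount_compress_add_le {Q Q' : Finset (Site d)} (h : Q' ⊆ Q) (t : ℝ) :
    eigenvalueCount (compress_isSymmetric hH Q) t + Q'.card * Module.finrank 𝕜 E ≤
      eigenvalueCount (compress_isSymmetric hH Q') t + Q.card * Module.finrank 𝕜 E := by
  obtain ⟨U, hU, hdim, hUt⟩ := exists_le_supportedIn_lt_re_inner hH Q' t
  have := finrank_add_eigenvalueCount_le hH (hU.trans (supportedIn_mono h)) hUt
  omega

omit [FiniteDimensional 𝕜 E] hH in
theorem inner_apply_eq_zero_of_block {Q₁ Q₂ : Finset (Site d)}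
    (h : ∀ x ∈ Q₁, ∀ y ∈ Q₂, block H y x = 0) {u v : L2 d E}
    (hu : u ∈ supportedIn 𝕜 E Q₁) (hv : v ∈ supportedIn 𝕜 E Q₂) : inner 𝕜 (H u) v = 0 := by
  rw [inner_eq_sum_of_mem_supportedIn _ hv]
  refine Finset.sum_eq_zero fun y hy => ?_
  rw [apply_eq_sum_block H hu, Finset.sum_eq_zero fun x hx => by
    rw [h x hx y hy, LinearMap.zero_apply], inner_zero_left]

omit [FiniteDimensional 𝕜 E] in
-- One cross term vanishes by the hypothesis on blocks, the other by symmetry of `H`.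
theorem re_inner_add_of_block {Q₁ Q₂ : Finset (Site d)} (hd : Disjoint Q₁ Q₂)
    (h : ∀ x ∈ Q₁, ∀ y ∈ Q₂, block H y x = 0) {u v : L2 d E}
    (hu : u ∈ supportedIn 𝕜 E Q₁) (hv : v ∈ supportedIn 𝕜 E Q₂) :
    RCLike.re (inner 𝕜 (H (u + v)) (u + v)) =
        RCLike.re (inner 𝕜 (H u) u) + RCLike.re (inner 𝕜 (H v) v) ∧
      ‖u + v‖ ^ 2 = ‖u‖ ^ 2 + ‖v‖ ^ 2 := by
  have huv : inner 𝕜 (H u) v = 0 := inner_apply_eq_zero_of_block h hu hv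
  have hvu : inner 𝕜 (H v) u = 0 := by rw [hH, ← inner_conj_symm, huv, map_zero]
  have h0 : inner 𝕜 u v = 0 := by
    rw [inner_eq_sum_of_mem_supportedIn u hv]
    exact Finset.sum_eq_zero fun y hy => by
      rw [hu y (Finset.disjoint_right.1 hd hy), inner_zero_left]
  constructor
  · rw [map_add, inner_add_left, inner_add_right, inner_add_right, huv, hvu]
    simp
  · simpa [sq] using norm_add_sq_eq_norm_sq_add_norm_sq_of_inner_eq_zero u v h0

/-- Sums of test subspaces for the two pieces are test subspaces for the union, because form and
squared norm both split. -/
theorem eigenvalueCount_compress_union {Q₁ Q₂ : Finset (Site d)} (hd : Disjoint Q₁ Q₂)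
    (h : ∀ x ∈ Q₁, ∀ y ∈ Q₂, block H y x = 0) (t : ℝ) :
    eigenvalueCount (compress_isSymmetric hH (Q₁ ∪ Q₂)) t =
      eigenvalueCount (compress_isSymmetric hH Q₁) t +
        eigenvalueCount (compress_isSymmetric hH Q₂) t := by
  have hs₁ : supportedIn 𝕜 E Q₁ ≤ supportedIn 𝕜 E (Q₁ ∪ Q₂) :=
    supportedIn_mono Finset.subset_union_left
  have hs₂ : supportedIn 𝕜 E Q₂ ≤ supportedIn 𝕜 E (Q₁ ∪ Q₂) :=
    supportedIn_mono Finset.subset_union_right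
  have hsup : ∀ {W₁ W₂ : Submodule 𝕜 (L2 d E)}, W₁ ≤ supportedIn 𝕜 E Q₁ →
      W₂ ≤ supportedIn 𝕜 E Q₂ →
      Module.finrank 𝕜 (W₁ ⊔ W₂ : Submodule 𝕜 (L2 d E)) =
        Module.finrank 𝕜 W₁ + Module.finrank 𝕜 W₂ := by
    intro W₁ W₂ h₁ h₂
    have := Submodule.finiteDimensional_of_le h₁
    have := Submodule.finiteDimensional_of_le h₂
    rw [← Submodule.finrank_sup_add_finrank_inf_eq,
      ((disjoint_supportedIn hd).mono h₁ h₂).eq_bot, finrank_bot, add_zero]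
  apply le_antisymm
  · obtain ⟨U₁, hU₁, hdim₁, ht₁⟩ := exists_le_supportedIn_lt_re_inner hH Q₁ t
    obtain ⟨U₂, hU₂, hdim₂, ht₂⟩ := exists_le_supportedIn_lt_re_inner hH Q₂ t
    have := finrank_add_eigenvalueCount_le hH (t := t)
      (sup_le (hU₁.trans hs₁) (hU₂.trans hs₂)) (by
        intro w hw hw0
        obtain ⟨u, hu, v, hv, rfl⟩ := Submodule.mem_sup.1 hw
        obtain ⟨e₁, e₂⟩ := re_inner_add_of_block hH hd h (hU₁ hu) (hU₂ hv)
        rw [e₁, e₂, mul_add]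
        -- Strictness must come from a nonzero summand, and either one may vanish.
        by_cases hu0 : u = 0
        · subst hu0
          simpa using ht₂ v hv (by simpa using hw0)
        · refine add_lt_add_of_lt_of_le (ht₁ u hu hu0) ?_
          by_cases hv0 : v = 0
          · simp [hv0]
          · exact (ht₂ v hv hv0).le)
    rw [hsup hU₁ hU₂, Finset.card_union_of_disjoint hd, add_mul] at this
    omega
  · obtain ⟨W₁, hW₁, hdim₁, ht₁⟩ := exists_le_supportedIn_re_inner_le hH Q₁ t
    obtain ⟨W₂, hW₂, hdim₂, ht₂⟩ := exists_le_supportedIn_re_inner_le hH Q₂ t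
    rw [← hdim₁, ← hdim₂, ← hsup hW₁ hW₂]
    refine finrank_le_eigenvalueCount hH (sup_le (hW₁.trans hs₁) (hW₂.trans hs₂)) ?_
    intro w hw
    obtain ⟨u, hu, v, hv, rfl⟩ := Submodule.mem_sup.1 hw
    obtain ⟨e₁, e₂⟩ := re_inner_add_of_block hH hd h (hW₁ hu) (hW₂ hv)
    rw [e₁, e₂, mul_add]
    exact add_le_add (ht₁ u hu) (ht₂ v hv)

theorem eigenvalueCount_compress_congr {Q Q' : Finset (Site d)} (h : Q = Q') (t : ℝ) :
    eigenvalueCount (compress_isSymmetric hH Q) t =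
      eigenvalueCount (compress_isSymmetric hH Q') t := by
  subst h
  rfl

theorem eigenvalueCount_compress_empty (t : ℝ) :
    eigenvalueCount (compress_isSymmetric hH (∅ : Finset (Site d))) t = 0 := by
  have := eigenvalueCount_le_finrank (compress_isSymmetric hH (∅ : Finset (Site d))) t
  rw [finrank_supportedIn] at this
  simpa using this

theorem eigenvalueCount_compress_biUnion {ι : Type*} (s : Finset ι) (f : ι → Finset (Site d))
    (hd : ∀ i ∈ s, ∀ j ∈ s, i ≠ j → Disjoint (f i) (f j))
    (h : ∀ i ∈ s, ∀ j ∈ s, i ≠ j → ∀ x ∈ f i, ∀ y ∈ f j, block H y x = 0) (t : ℝ) :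
    eigenvalueCount (compress_isSymmetric hH (s.biUnion f)) t =
      ∑ i ∈ s, eigenvalueCount (compress_isSymmetric hH (f i)) t := by
  classical
  induction s using Finset.induction_on with
  | empty => simpa using eigenvalueCount_compress_empty hH t
  | insert i s hi ih =>
    have hne : ∀ j ∈ s, i ≠ j := fun j hj hij => hi (hij ▸ hj)
    rw [Finset.sum_insert hi, ← ih (fun a ha b hb => hd a (by simp [ha]) b (by simp [hb]))
      (fun a ha b hb => h a (by simp [ha]) b (by simp [hb])), ← eigenvalueCount_compress_union hH]
    · exact eigenvalueCount_compress_congr hH Finset.biUnion_insert t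
    · rw [Finset.disjoint_biUnion_right]
      exact fun j hj => hd i (by simp) j (by simp [hj]) (hne j hj)
    · intro x hx y hy
      obtain ⟨j, hj, hyj⟩ := Finset.mem_biUnion.1 hy
      exact h i (by simp) j (by simp [hj]) (hne j hj) x hx y hyj

/-- On vectors supported in `Q`, `relabel` is isometric and preserves the quadratic form, so it
transports test subspaces. -/
theorem eigenvalueCount_compress_le_map (γ : Equiv.Perm (Site d)) {Q : Finset (Site d)}
    (h : ∀ x ∈ Q, ∀ y ∈ Q, block H y x = block H (γ y) (γ x)) (t : ℝ) :
    eigenvalueCount (compress_isSymmetric hH Q) t ≤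
      eigenvalueCount (compress_isSymmetric hH (Q.map γ.toEmbedding)) t := by
  obtain ⟨W, hW, hdim, ht⟩ := exists_le_supportedIn_re_inner_le hH Q t
  have hinner : ∀ w, ∀ u ∈ supportedIn 𝕜 E Q,
      inner 𝕜 w (relabel 𝕜 γ Q u) = ∑ y ∈ Q, inner 𝕜 (w (γ y)) (u y) := by
    intro w u hu
    rw [inner_eq_sum_of_mem_supportedIn w (relabel_mem γ hu), Finset.sum_map]
    exact Finset.sum_congr rfl fun y _ => by
      rw [Equiv.coe_toEmbedding, relabel_apply γ hu]
  have hnorm : ∀ u ∈ supportedIn 𝕜 E Q, ‖relabel 𝕜 γ Q u‖ = ‖u‖ := by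
    intro u hu
    have : (inner 𝕜 (relabel 𝕜 γ Q u) (relabel 𝕜 γ Q u)) = inner 𝕜 u u := by
      rw [hinner _ u hu, inner_eq_sum_of_mem_supportedIn u hu]
      exact Finset.sum_congr rfl fun y _ => by rw [relabel_apply γ hu]
    rw [@norm_eq_sqrt_re_inner 𝕜, this, ← @norm_eq_sqrt_re_inner 𝕜]
  have hform : ∀ u ∈ supportedIn 𝕜 E Q,
      inner 𝕜 (H (relabel 𝕜 γ Q u)) (relabel 𝕜 γ Q u) = inner 𝕜 (H u) u := by
    intro u hu
    rw [hinner _ u hu, inner_eq_sum_of_mem_supportedIn _ hu]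
    refine Finset.sum_congr rfl fun y hy => ?_
    rw [apply_eq_sum_block H (relabel_mem γ hu), apply_eq_sum_block H hu, Finset.sum_map]
    congr 1
    exact Finset.sum_congr rfl fun x hx => by
      rw [Equiv.coe_toEmbedding, relabel_apply γ hu, h x hx y hy]
  have hle : W.map (relabel 𝕜 γ Q) ≤ supportedIn 𝕜 E (Q.map γ.toEmbedding) := by
    rintro _ ⟨u, hu, rfl⟩
    exact relabel_mem γ (hW hu)
  have := Submodule.finiteDimensional_of_le hle
  -- `relabel` kills everything outside `Q`; it is injective only after restriction to `W`, where it
  -- preserves norms.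
  have hfr : Module.finrank 𝕜 W ≤ Module.finrank 𝕜 (W.map (relabel 𝕜 γ Q)) := by
    refine LinearMap.finrank_le_finrank_of_injective
      (f := ((relabel 𝕜 γ Q).domRestrict W).codRestrict _ fun u => ⟨u, u.2, rfl⟩) ?_
    rw [injective_iff_map_eq_zero]
    intro u hu
    have h0 : relabel 𝕜 γ Q (u : L2 d E) = 0 := congrArg Subtype.val hu
    have := hnorm u (hW u.2)
    rw [h0, norm_zero] at this
    exact Subtype.ext (norm_eq_zero.1 this.symm)
  rw [← hdim]
  refine hfr.trans (finrank_le_eigenvalueCount hH hle ?_)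
  rintro _ ⟨u, hu, rfl⟩
  rw [hform u (hW hu), hnorm u (hW hu)]
  exact ht u hu

theorem eigenvalueCount_compress_map (γ : Equiv.Perm (Site d)) {Q : Finset (Site d)}
    (h : ∀ x ∈ Q, ∀ y ∈ Q, block H y x = block H (γ y) (γ x)) (t : ℝ) :
    eigenvalueCount (compress_isSymmetric hH (Q.map γ.toEmbedding)) t =
      eigenvalueCount (compress_isSymmetric hH Q) t := by
  refine le_antisymm ?_ (eigenvalueCount_compress_le_map hH γ h t)
  refine (eigenvalueCount_compress_le_map hH γ⁻¹ ?_ t).trans_eq ?_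
  · intro x' hx' y' hy'
    obtain ⟨x, hx, rfl⟩ := Finset.mem_map.1 hx'
    obtain ⟨y, hy, rfl⟩ := Finset.mem_map.1 hy'
    simpa using (h x hx y hy).symm
  · refine eigenvalueCount_compress_congr hH ?_ t
    rw [Finset.map_map]
    convert Finset.map_refl
    ext x
    simp

end Lattice

/-! ### Graph automorphisms are affine and preserve cubes -/

section Automorphisms

variable {d : ℕ}

theorem adjacent_iff_dotProduct {x y : Site d} : Adjacent x y ↔ (x - y) ⬝ᵥ (x - y) = 1 := by
  simp [Adjacent, dotProduct, sq]

theorem dotProduct_self_nonneg (v : Site d) : 0 ≤ v ⬝ᵥ v :=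
  Finset.sum_nonneg fun i _ => mul_self_nonneg (v i)

/-- Since `|a ± b|² = 2 ± 2 a·b ≥ 0`, the integer `a·b` is `-1`, `0` or `1`, and the extreme values
force `a = ∓b` to cancel exactly, i.e. `a = -b` or `a = b`. -/
theorem eq_or_eq_neg_or_dotProduct_eq_zero {a b : Site d} (ha : a ⬝ᵥ a = 1) (hb : b ⬝ᵥ b = 1) :
    a = b ∨ a = -b ∨ a ⬝ᵥ b = 0 := by
  have h₁ : (a - b) ⬝ᵥ (a - b) = 2 - 2 * a ⬝ᵥ b := by
    simp only [sub_dotProduct, dotProduct_sub, ha, hb, dotProduct_comm b a]; ring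
  have h₂ : (a + b) ⬝ᵥ (a + b) = 2 + 2 * a ⬝ᵥ b := by
    simp only [add_dotProduct, dotProduct_add, ha, hb, dotProduct_comm b a]; ring
  have p₁ := dotProduct_self_nonneg (a - b)
  have p₂ := dotProduct_self_nonneg (a + b)
  obtain h | h | h : a ⬝ᵥ b = 1 ∨ a ⬝ᵥ b = -1 ∨ a ⬝ᵥ b = 0 := by omega
  · exact Or.inl (sub_eq_zero.1 (dotProduct_self_eq_zero.1 (by rw [h₁, h]; rfl)))
  · exact Or.inr (Or.inl (eq_neg_of_add_eq_zero_left
      (dotProduct_self_eq_zero.1 (by rw [h₂, h]; rfl))))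
  · exact Or.inr (Or.inr h)

/-- The fourth vertex of a unit square is determined by the other three; opposite vectors `a = -b`
have no common neighbour besides `0`. -/
theorem eq_add_of_common_neighbour {a b c : Site d} (ha : a ⬝ᵥ a = 1) (hb : b ⬝ᵥ b = 1)
    (hab : a ≠ b) (hc : c ≠ 0) (hca : (c - a) ⬝ᵥ (c - a) = 1) (hcb : (c - b) ⬝ᵥ (c - b) = 1) :
    c = a + b ∧ a ⬝ᵥ b = 0 := by
  have e₁ : (c - a) ⬝ᵥ (c - a) = c ⬝ᵥ c - 2 * c ⬝ᵥ a + 1 := by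
    simp only [sub_dotProduct, dotProduct_sub, ha, dotProduct_comm a c]; ring
  have e₂ : (c - b) ⬝ᵥ (c - b) = c ⬝ᵥ c - 2 * c ⬝ᵥ b + 1 := by
    simp only [sub_dotProduct, dotProduct_sub, hb, dotProduct_comm b c]; ring
  obtain h | rfl | h := eq_or_eq_neg_or_dotProduct_eq_zero ha hb
  · exact absurd h hab
  · rw [dotProduct_neg] at e₁
    exact absurd (dotProduct_self_eq_zero.1 (by linarith)) hc
  · refine ⟨?_, h⟩
    have e₃ : (c - (a + b)) ⬝ᵥ (c - (a + b)) = c ⬝ᵥ c - 2 * c ⬝ᵥ a - 2 * c ⬝ᵥ b + 2 := by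
      simp only [sub_dotProduct, dotProduct_sub, add_dotProduct, dotProduct_add, ha, hb, h,
        dotProduct_comm a c, dotProduct_comm b c, dotProduct_comm b a]
      ring
    have p₃ := dotProduct_self_nonneg (c - (a + b))
    have p₀ := dotProduct_self_nonneg c
    -- With `m = c·a = c·b` one has `|c|² = 2m` and `|c - (a + b)|² = 2 - 2m`.
    obtain hm | hm : c ⬝ᵥ a = 0 ∨ c ⬝ᵥ a = 1 := by omega
    · exact absurd (dotProduct_self_eq_zero.1 (by linarith)) hc
    · exact sub_eq_zero.1 (dotProduct_self_eq_zero.1 (by linarith))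

/-- The unit vectors generate `ℤ^d`. This replaces inductions along coordinates when proving
increments constant. -/
theorem eq_of_periodic_single {α : Type*} {f : Site d → α}
    (h : ∀ i, Function.Periodic f (Pi.single i 1)) (x : Site d) : f x = f 0 := by
  have hs : ∀ s : Finset (Fin d), Function.Periodic f (∑ i ∈ s, x i • Pi.single i 1) := by
    intro s
    induction s using Finset.induction_on with
    | empty => intro y; simp
    | insert i s hi ih =>
      rw [Finset.sum_insert hi]
      exact ((h i).zsmul (x i)).add_period ih
  have hx : x = ∑ i, x i • Pi.single i (1 : ℤ) := by
    ext j
    simp [Finset.sum_apply, Pi.single_apply]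
  have := hs Finset.univ 0
  rwa [← hx, zero_add] at this

section

variable {γ : Equiv.Perm (Site d)} (hγ : γ ∈ automorphismGroup d)
include hγ

theorem automorphism_step_sq {x u : Site d} (hu : u ⬝ᵥ u = 1) :
    (γ (x + u) - γ x) ⬝ᵥ (γ (x + u) - γ x) = 1 := by
  have : Adjacent (x + u) x := adjacent_iff_dotProduct.2 (by simpa using hu)
  exact adjacent_iff_dotProduct.1 ((hγ _ _).2 this)

/-- The square `x, x + u, x + v, x + u + v` goes to a square, whose opposite sides are equal. -/
theorem automorphism_step_of_orthogonal {x u v : Site d} (hu : u ⬝ᵥ u = 1) (hv : v ⬝ᵥ v = 1)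
    (huv : u ⬝ᵥ v = 0) :
    γ (x + v + u) - γ (x + v) = γ (x + u) - γ x ∧
      (γ (x + u) - γ x) ⬝ᵥ (γ (x + v) - γ x) = 0 := by
  have hne : u ≠ v := by
    rintro rfl
    omega
  have hne0 : v + u ≠ 0 := by
    intro h
    have h' := congrArg (· ⬝ᵥ u) h
    simp only [add_dotProduct, hu, dotProduct_comm v u, huv, zero_dotProduct] at h'
    omega
  obtain ⟨h₁, h₂⟩ := eq_add_of_common_neighbour (c := γ (x + v + u) - γ x)
    (automorphism_step_sq hγ (x := x) hu) (automorphism_step_sq hγ (x := x) hv)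
    (fun h => hne (by simpa using h))
    (fun h => hne0 (by simpa [sub_eq_zero, add_assoc] using h))
    (by
      rw [sub_sub_sub_cancel_right, add_right_comm]
      exact automorphism_step_sq hγ hv)
    (by
      rw [sub_sub_sub_cancel_right]
      exact automorphism_step_sq hγ hu)
  refine ⟨?_, h₂⟩
  rw [← sub_add_sub_cancel _ (γ (x + v)) (γ x)] at h₁
  exact add_right_cancel h₁

/-- The sites `x` and `x + 2u` have only one common neighbour. A right-angled turn of the image path
would give their images two, and a reversal would contradict injectivity. -/
theorem automorphism_step_of_parallel {x u : Site d} (hu : u ⬝ᵥ u = 1) :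
    γ (x + u + u) - γ (x + u) = γ (x + u) - γ x := by
  have ha := automorphism_step_sq hγ (x := x) hu
  have ha' := automorphism_step_sq hγ (x := x + u) hu
  have hu0 : u ≠ 0 := by
    rintro rfl
    simp at hu
  obtain h | h | h := eq_or_eq_neg_or_dotProduct_eq_zero ha' ha
  · exact h
  · rw [neg_sub, sub_left_inj, EmbeddingLike.apply_eq_iff_eq, add_assoc, add_eq_left,
      ← two_nsmul, smul_eq_zero] at h
    exact absurd (h.resolve_left two_ne_zero) hu0
  · exfalso
    set a := γ (x + u) - γ x with hadef
    set a' := γ (x + u + u) - γ (x + u) with hadef'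
    -- `γ w` is the other corner completing the square spanned by `a` and `a'`.
    obtain ⟨w, hw⟩ := γ.surjective (γ x + a')
    have h₁ : Adjacent w x := by
      rw [← hγ, hw, adjacent_iff_dotProduct, add_sub_cancel_left]
      exact ha'
    have h₂ : Adjacent w (x + u + u) := by
      rw [← hγ, hw, adjacent_iff_dotProduct]
      have : γ x + a' - γ (x + u + u) = -a := by rw [hadef, hadef']; abel
      rw [this, neg_dotProduct_neg]
      exact ha
    rw [adjacent_iff_dotProduct] at h₁ h₂
    have h₃ : w = x + u := by
      have e₁ : (w - (x + u + u)) ⬝ᵥ (w - (x + u + u)) =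
          (w - x) ⬝ᵥ (w - x) - 4 * (w - x) ⬝ᵥ u + 4 * u ⬝ᵥ u := by
        have : w - (x + u + u) = (w - x) - u - u := by abel
        rw [this]
        simp only [sub_dotProduct _ u, dotProduct_sub _ _ u, dotProduct_comm u (w - x)]
        ring
      have e₂ : (w - (x + u)) ⬝ᵥ (w - (x + u)) =
          (w - x) ⬝ᵥ (w - x) - 2 * (w - x) ⬝ᵥ u + u ⬝ᵥ u := by
        have : w - (x + u) = (w - x) - u := by abel
        rw [this]
        simp only [sub_dotProduct _ u, dotProduct_sub _ _ u, dotProduct_comm u (w - x)]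
        ring
      exact sub_eq_zero.1 (dotProduct_self_eq_zero.1 (by omega))
    have h₄ : a' = a := by
      rw [hadef, ← h₃, hw, add_sub_cancel_left]
    rw [h₄, ha] at h
    exact one_ne_zero h

theorem automorphism_step_eq (i : Fin d) (x : Site d) :
    γ (x + Pi.single i 1) - γ x = γ (Pi.single i 1) - γ 0 := by
  have := eq_of_periodic_single (f := fun x => γ (x + Pi.single i 1) - γ x) (fun j y => ?_) x
  · simpa using this
  · by_cases hij : i = j
    · subst hij
      exact automorphism_step_of_parallel hγ (by simp)
    · exact (automorphism_step_of_orthogonal hγ (by simp) (by simp)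
        (by simp [hij])).1

theorem automorphism_sub_apply (x y : Site d) (k : Fin d) :
    γ x k - γ y k = ∑ i, (x i - y i) * (γ (Pi.single i 1) k - γ 0 k) := by
  have key := eq_of_periodic_single
    (f := fun x => γ x - ∑ i, x i • (γ (Pi.single i 1) - γ 0)) (fun j z => by
      have := automorphism_step_eq hγ j z
      simp only [Pi.add_apply, add_smul, Finset.sum_add_distrib, Pi.single_apply, ite_smul,
        zero_smul, Finset.sum_ite_eq', Finset.mem_univ, if_true, one_smul]
      rw [sub_eq_iff_eq_add] at this
      rw [this]
      abel)
  have hx := congrFun (key x) k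
  have hy := congrFun (key y) k
  simp only [Pi.sub_apply, Finset.sum_apply, Pi.smul_apply, smul_eq_mul] at hx hy
  simp only [sub_mul, Finset.sum_sub_distrib] at hx hy ⊢
  linarith

/-- The increments are orthonormal rows of a square integer matrix, so its columns are unit vectors
too. -/
theorem sum_sq_automorphism_step (k : Fin d) :
    ∑ i, (γ (Pi.single i 1) k - γ 0 k) ^ 2 = 1 := by
  let D : Matrix (Fin d) (Fin d) ℤ := fun i => γ (Pi.single i 1) - γ 0
  have hD : D * D.transpose = 1 := by
    ext i j
    have : (D * D.transpose) i j =
      (γ (0 + Pi.single i 1) - γ 0) ⬝ᵥ (γ (0 + Pi.single j 1) - γ 0) := by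
      rw [zero_add, zero_add]; rfl
    rw [this]
    by_cases hij : i = j
    · subst hij
      rw [Matrix.one_apply_eq]
      exact automorphism_step_sq hγ (by simp)
    · rw [Matrix.one_apply_ne hij]
      exact (automorphism_step_of_orthogonal hγ (by simp) (by simp)
        (by simp [hij])).2
  have hD' : D.transpose * D = 1 := mul_eq_one_comm.1 hD
  have := congrFun (congrFun hD' k) k
  rw [Matrix.one_apply_eq, Matrix.mul_apply] at this
  exact (Finset.sum_congr rfl fun i _ => sq _).trans this

end

theorem mem_cubeAt {R : ℕ} {x z : Site d} : z ∈ cubeAt R x ↔ ∀ i, |z i - x i| ≤ R := by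
  simp only [cubeAt, Finset.mem_Icc, Pi.le_def, ← forall_and]
  refine forall_congr' fun i => ?_
  rw [abs_le]
  constructor <;> rintro ⟨h, h'⟩ <;> constructor <;> linarith

/-- Integers satisfy `|m| ≤ m²`, so the absolute values in each column sum to at most `1`, and the
maximum norm does not grow. -/
theorem automorphism_mem_cubeAt {γ : Equiv.Perm (Site d)} (hγ : γ ∈ automorphismGroup d)
    {R : ℕ} {x z : Site d} (h : z ∈ cubeAt R x) : γ z ∈ cubeAt R (γ x) := by
  rw [mem_cubeAt] at h ⊢
  intro k
  rw [automorphism_sub_apply hγ]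
  calc |∑ i, (z i - x i) * (γ (Pi.single i 1) k - γ 0 k)|
      ≤ ∑ i, |(z i - x i) * (γ (Pi.single i 1) k - γ 0 k)| := Finset.abs_sum_le_sum_abs _ _
    _ ≤ ∑ i, (R : ℤ) * (γ (Pi.single i 1) k - γ 0 k) ^ 2 := by
        refine Finset.sum_le_sum fun i _ => ?_
        rw [abs_mul]
        refine mul_le_mul (h i) ?_ (abs_nonneg _) (by positivity)
        rw [← sq_abs]
        exact Int.le_self_sq _
    _ = R := by rw [← Finset.mul_sum, sum_sq_automorphism_step hγ, mul_one]

theorem translationGroup_le_automorphismGroup : translationGroup d ≤ automorphismGroup d := by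
  rintro γ ⟨t, ht⟩ x y
  simp [Adjacent, ht]

theorem map_cubeAt {γ : Equiv.Perm (Site d)} (hγ : γ ∈ automorphismGroup d) (R : ℕ)
    (x : Site d) : (cubeAt R x).map γ.toEmbedding = cubeAt R (γ x) := by
  ext z
  obtain ⟨z, rfl⟩ := γ.surjective z
  rw [← Equiv.coe_toEmbedding, Finset.mem_map']
  refine ⟨automorphism_mem_cubeAt hγ, fun h => ?_⟩
  simpa using automorphism_mem_cubeAt (inv_mem hγ) h

end Automorphisms

/-! ### Interiors, boundaries and cubes -/

section Interior

variable {d : ℕ}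

/-- The points of `Q` whose surrounding cube of radius `R` is contained in `Q`. -/
noncomputable def interiorOf (R : ℕ) (Q : Finset (Site d)) : Finset (Site d) :=
  Q.filter fun x => cubeAt R x ⊆ Q

theorem self_mem_cubeAt (R : ℕ) (x : Site d) : x ∈ cubeAt R x := by simp [mem_cubeAt]

theorem mem_cubeAt_comm {R : ℕ} {x y : Site d} : x ∈ cubeAt R y ↔ y ∈ cubeAt R x := by
  simp only [mem_cubeAt, abs_sub_comm]

theorem cubeAt_mono {R R' : ℕ} (h : R ≤ R') (x : Site d) : cubeAt R x ⊆ cubeAt R' x := by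
  intro z hz
  rw [mem_cubeAt] at hz ⊢
  exact fun i => (hz i).trans (by exact_mod_cast h)

theorem mem_interiorOf {R : ℕ} {Q : Finset (Site d)} {x : Site d} :
    x ∈ interiorOf R Q ↔ cubeAt R x ⊆ Q := by
  rw [interiorOf, Finset.mem_filter, and_iff_right_iff_imp]
  exact fun h => h (self_mem_cubeAt R x)

theorem interiorOf_subset (R : ℕ) (Q : Finset (Site d)) : interiorOf R Q ⊆ Q :=
  Finset.filter_subset _ _

theorem map_interiorOf {γ : Equiv.Perm (Site d)} (hγ : γ ∈ automorphismGroup d) (R : ℕ)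
    (Q : Finset (Site d)) :
    (interiorOf R Q).map γ.toEmbedding = interiorOf R (Q.map γ.toEmbedding) := by
  ext z
  obtain ⟨z, rfl⟩ := γ.surjective z
  rw [← Equiv.coe_toEmbedding, Finset.mem_map', mem_interiorOf, mem_interiorOf,
    Equiv.coe_toEmbedding, ← map_cubeAt hγ, Finset.map_subset_map]

theorem card_cubeAt (R : ℕ) (x : Site d) : (cubeAt R x).card = (2 * R + 1) ^ d := by
  rw [cubeAt, Pi.card_Icc]
  simp only [Int.card_Icc]
  rw [Finset.prod_congr rfl (g := fun _ => 2 * R + 1) fun i _ => by omega]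
  simp

theorem exists_adjacent_closer {z w : Site d} {M : ℕ} (hw : w ∈ cubeAt M z) (hne : w ≠ z) :
    ∃ w' ∈ cubeAt M z, Adjacent w' w ∧
      ∑ i, (w' i - z i).natAbs < ∑ i, (w i - z i).natAbs := by
  obtain ⟨i, hi⟩ := Function.ne_iff.1 hne
  rw [mem_cubeAt] at hw
  have hwi := hw i
  rw [abs_le] at hwi
  obtain ⟨s, hs, hs', hsz⟩ : ∃ s : ℤ, (s - w i) ^ 2 = 1 ∧ |s - z i| ≤ M ∧
      (s - z i).natAbs < (w i - z i).natAbs := by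
    rcases lt_or_gt_of_ne hi with h | h
    · refine ⟨w i + 1, by ring, ?_, by omega⟩
      rw [abs_le]; constructor <;> linarith
    · refine ⟨w i - 1, by ring, ?_, by omega⟩
      rw [abs_le]; constructor <;> linarith
  refine ⟨Function.update w i s, mem_cubeAt.2 fun j => ?_, ?_, ?_⟩
  · by_cases hj : j = i
    · subst hj; simpa using hs'
    · simpa [hj] using hw j
  · rw [Adjacent, Finset.sum_eq_single i]
    · simpa using hs
    · intro j _ hj; simp [hj]
    · simp
  · refine Finset.sum_lt_sum (fun j _ => ?_) ⟨i, Finset.mem_univ i, by simpa using hsz⟩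
    by_cases hj : j = i
    · subst hj; simpa using hsz.le
    · simp [hj]

/-- Induction on the `ℓ¹` distance from `z`: a path inside the cube can leave `Q` only through a
site of the inner boundary. -/
theorem cubeAt_subset_of_disjoint_innerBoundary {Q : Finset (Site d)} {z : Site d} {M : ℕ}
    (hz : z ∈ Q) (h : ∀ w ∈ cubeAt M z, w ∉ innerBoundary Q) : cubeAt M z ⊆ Q := by
  have : ∀ n : ℕ, ∀ w ∈ cubeAt M z, ∑ i, (w i - z i).natAbs = n → w ∈ Q := by
    intro n
    induction n using Nat.strong_induction_on with
    | _ n ih =>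
      intro w hw hn
      by_cases hne : w = z
      · exact hne ▸ hz
      · obtain ⟨w', hw', hadj, hlt⟩ := exists_adjacent_closer hw hne
        have hwQ := ih _ (hn ▸ hlt) w' hw' rfl
        by_contra hcon
        classical
        exact h w' hw' (by
          rw [innerBoundary, Finset.mem_filter]
          exact ⟨hwQ, w, hadj, hcon⟩)
  exact fun w hw => this _ w hw rfl

theorem card_sdiff_interiorOf_le (M : ℕ) (Q : Finset (Site d)) :
    (Q \ interiorOf M Q).card ≤ (innerBoundary Q).card * (2 * M + 1) ^ d := by
  have hsub : Q \ interiorOf M Q ⊆ (innerBoundary Q).biUnion (cubeAt M) := by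
    intro z hz
    rw [Finset.mem_sdiff, mem_interiorOf] at hz
    by_contra hcon
    refine hz.2 (cubeAt_subset_of_disjoint_innerBoundary hz.1 fun w hw hwb => hcon ?_)
    exact Finset.mem_biUnion.2 ⟨w, hwb, mem_cubeAt_comm.1 hw⟩
  refine (Finset.card_le_card hsub).trans (Finset.card_biUnion_le_card_mul _ _ _ fun x _ => ?_)
  rw [card_cubeAt]

theorem mem_translate_cube {M : ℕ} {x z : Site d} :
    z ∈ translate x (cube d M) ↔ ∀ i, x i ≤ z i ∧ z i < x i + M := by
  simp only [translate, cube, Finset.mem_map, Equiv.coe_toEmbedding, Equiv.coe_addLeft,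
    Finset.mem_Icc, Pi.le_def, ← forall_and]
  constructor
  · rintro ⟨y, hy, rfl⟩ i
    have := hy i
    simp only [Pi.zero_apply, Pi.add_apply] at this ⊢
    omega
  · intro h
    refine ⟨z - x, fun i => ?_, by abel⟩
    have := h i
    simp only [Pi.zero_apply, Pi.sub_apply]
    omega

theorem card_translate_cube (M : ℕ) (x : Site d) : (translate x (cube d M)).card = M ^ d := by
  rw [translate, Finset.card_map, cube, Pi.card_Icc]
  simp

/-- The interior contains the concentric cube of side `M - 2R`; the truncated subtraction is
harmless for small `M`. -/
theorem card_interiorOf_translate_cube_ge (M R : ℕ) (x : Site d) :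
    (M - 2 * R) ^ d ≤ (interiorOf R (translate x (cube d M))).card := by
  have : (translate (fun i => x i + R) (cube d (M - 2 * R))) ⊆
      interiorOf R (translate x (cube d M)) := by
    intro z hz
    rw [mem_interiorOf]
    intro w hw
    rw [mem_translate_cube] at hz ⊢
    rw [mem_cubeAt] at hw
    intro i
    have h₁ := hz i
    have h₂ := abs_le.1 (hw i)
    omega
  simpa [card_translate_cube] using Finset.card_le_card this

end Interior

/-! ### Equivalent patterns give equal counts -/

section Patterns

variable {d : ℕ} {A : Type*}

theorem Pattern.ext_iff' {P P' : Pattern d A} :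
    P = P' ↔ ∃ h : P.dom = P'.dom, ∀ x (hx : x ∈ P.dom), P.col ⟨x, hx⟩ = P'.col ⟨x, h ▸ hx⟩ := by
  constructor
  · rintro rfl
    exact ⟨rfl, fun _ _ => rfl⟩
  · obtain ⟨D, c⟩ := P
    obtain ⟨D', c'⟩ := P'
    rintro ⟨h, hc⟩
    obtain rfl : D = D' := h
    congr 1
    ext x
    exact hc x x.2

theorem shift_colouringRestrict_eq_iff {Λ : Site d → A} {γ : Equiv.Perm (Site d)}
    {Q Q' : Finset (Site d)} :
    (colouringRestrict Λ Q).shift γ = colouringRestrict Λ Q' ↔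
      Q.map γ.toEmbedding = Q' ∧ ∀ x ∈ Q, Λ x = Λ (γ x) := by
  rw [Pattern.ext_iff']
  constructor
  · rintro ⟨h, hc⟩
    refine ⟨h, fun x hx => ?_⟩
    simpa [Pattern.shift, colouringRestrict] using hc (γ x) (Finset.mem_map_of_mem _ hx)
  · rintro ⟨h, hc⟩
    refine ⟨h, fun x hx => ?_⟩
    obtain ⟨y, hy, rfl⟩ := Finset.mem_map.1 hx
    simpa [Pattern.shift, colouringRestrict] using hc y hy

theorem Pattern.shift_shift (γ δ : Equiv.Perm (Site d)) (P : Pattern d A) :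
    (P.shift γ).shift δ = P.shift (δ * γ) := by
  rw [Pattern.ext_iff']
  exact ⟨Finset.map_map _ _ _, fun x hx => rfl⟩

theorem Pattern.shift_one (P : Pattern d A) : P.shift 1 = P := by
  rw [Pattern.ext_iff']
  exact ⟨Finset.map_refl, fun x hx => rfl⟩

theorem Pattern.equivalent_equivalence (Γ : Subgroup (Equiv.Perm (Site d))) :
    Equivalence (Pattern.Equivalent (A := A) Γ) where
  refl P := ⟨1, Γ.one_mem, P.shift_one⟩
  symm := by
    rintro P _ ⟨γ, hγ, rfl⟩
    refine ⟨γ⁻¹, Γ.inv_mem hγ, ?_⟩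
    rw [Pattern.shift_shift, inv_mul_cancel, Pattern.shift_one]
  trans := by
    rintro P _ _ ⟨γ, hγ, rfl⟩ ⟨δ, hδ, rfl⟩
    exact ⟨δ * γ, Γ.mul_mem hδ hγ, (P.shift_shift γ δ).symm⟩

/-- For interior sites the cubes tested by invariance lie in `Q`, where `γ` preserves colours. Hence
`γ` matches the blocks, and it maps interior to interior. -/
theorem eigenvalueCount_interiorOf_eq {𝕜 : Type*} [RCLike 𝕜] {E : Type*} [NormedAddCommGroup E]
    [InnerProductSpace 𝕜 E] [FiniteDimensional 𝕜 E]
    {Γ : Subgroup (Equiv.Perm (Site d))} (hΓ : Γ ≤ automorphismGroup d) {Λ : Site d → A}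
    {H : L2 d E →ₗ[𝕜] L2 d E} (hH : H.IsSymmetric) {R₀ R : ℕ} (hR : R₀ ≤ R)
    (hinv : ∀ x y : Site d, ∀ γ ∈ Γ,
      (colouringRestrict Λ (cubeAt R₀ x ∪ cubeAt R₀ y)).shift γ =
          colouringRestrict Λ (cubeAt R₀ (γ x) ∪ cubeAt R₀ (γ y)) →
        block H y x = block H (γ y) (γ x))
    {Q Q' : Finset (Site d)}
    (h : (colouringRestrict Λ Q).Equivalent Γ (colouringRestrict Λ Q')) (t : ℝ) :
    eigenvalueCount (compress_isSymmetric hH (interiorOf R Q)) t =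
      eigenvalueCount (compress_isSymmetric hH (interiorOf R Q')) t := by
  obtain ⟨γ, hγ, h⟩ := h
  obtain ⟨rfl, hcol⟩ := shift_colouringRestrict_eq_iff.1 h
  rw [← eigenvalueCount_compress_map hH γ]
  · exact eigenvalueCount_compress_congr hH (map_interiorOf (hΓ hγ) R Q) t
  · intro x hx y hy
    refine hinv x y γ hγ (shift_colouringRestrict_eq_iff.2 ⟨?_, fun z hz => hcol z ?_⟩)
    · rw [Finset.map_union, map_cubeAt (hΓ hγ), map_cubeAt (hΓ hγ)]
    · rw [mem_interiorOf] at hx hy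
      exact Finset.union_subset ((cubeAt_mono hR x).trans hx) ((cubeAt_mono hR y).trans hy) hz

end Patterns

/-! ### Tilings by cubes and the averaged error bound -/

section Tiling

variable {d : ℕ}

open Classical in
/-- The corners of the cubes of side `M` contained in `Q`. -/
noncomputable def anchors (M : ℕ) (Q : Finset (Site d)) : Finset (Site d) :=
  Q.filter fun x => translate x (cube d M) ⊆ Q

theorem mem_anchors {M : ℕ} {Q : Finset (Site d)} {x : Site d} :
    x ∈ anchors M Q ↔ x ∈ Q ∧ translate x (cube d M) ⊆ Q := by
  rw [anchors, Finset.mem_filter]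

/-- The residue class of a site modulo `M`. -/
def residue (M : ℕ) (x : Site d) : Fin d → ZMod M := fun i => (x i : ZMod M)

theorem disjoint_translate_cube {M : ℕ} {x y : Site d} (h : residue M x = residue M y)
    (hne : x ≠ y) : Disjoint (translate x (cube d M)) (translate y (cube d M)) := by
  rw [Finset.disjoint_left]
  intro z hx hy
  rw [mem_translate_cube] at hx hy
  apply hne
  ext i
  have h₁ := hx i
  have h₂ := hy i
  have h₃ : (M : ℤ) ∣ y i - x i := (ZMod.intCast_eq_intCast_iff_dvd_sub _ _ _).1 (congrFun h i)
  obtain ⟨k, hk⟩ := h₃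
  have hk0 : k = 0 := by
    have : |(M : ℤ) * k| < M := by rw [← hk, abs_lt]; constructor <;> linarith
    rw [abs_mul, Nat.abs_cast] at this
    have h5 : |k| < 1 := by
      by_contra! hcon
      nlinarith [(Nat.cast_nonneg M : (0 : ℤ) ≤ M)]
    exact Int.abs_lt_one_iff.1 h5
  rw [hk0, mul_zero] at hk
  linarith

theorem exists_residue_mem_translate_cube {M : ℕ} [NeZero M] (r : Fin d → ZMod M)
    (z : Site d) : ∃ x, residue M x = r ∧ z ∈ translate x (cube d M) := by
  have hM : (0 : ℤ) < M := by exact_mod_cast Nat.pos_of_neZero M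
  -- Round each coordinate of `z` down to the grid `r + Mℤ`.
  refine ⟨fun i => z i - (z i - (r i).val) % M, ?_, ?_⟩
  · ext i
    have : ((z i - ((z i - (r i).val) % M) : ℤ) : ZMod M) = r i := by
      rw [Int.cast_sub, ZMod.intCast_mod]
      simp
    exact this
  · rw [mem_translate_cube]
    intro i
    have h₁ := Int.emod_nonneg (z i - (r i).val) hM.ne'
    have h₂ := Int.emod_lt_of_pos (z i - (r i).val) hM
    constructor <;> linarith

theorem translate_cube_subset_cubeAt {M : ℕ} {x z : Site d} (hz : z ∈ translate x (cube d M)) :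
    translate x (cube d M) ⊆ cubeAt M z := by
  intro w hw
  rw [mem_translate_cube] at hz hw
  rw [mem_cubeAt]
  intro i
  have h₁ := hz i
  have h₂ := hw i
  rw [abs_le]
  constructor <;> linarith

open Classical in
/-- The corners in `anchors M Q` of a given residue class. -/
noncomputable def anchorsMod (M : ℕ) (Q : Finset (Site d)) (r : Fin d → ZMod M) :
    Finset (Site d) := (anchors M Q).filter fun x => residue M x = r

theorem mem_anchorsMod {M : ℕ} {Q : Finset (Site d)} {r : Fin d → ZMod M} {x : Site d} :
    x ∈ anchorsMod M Q r ↔ x ∈ anchors M Q ∧ residue M x = r := by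
  rw [anchorsMod, Finset.mem_filter]

/-- The union of the interiors of the cubes with corners in `anchorsMod M Q r`. -/
noncomputable def tiled (M R : ℕ) (Q : Finset (Site d)) (r : Fin d → ZMod M) :
    Finset (Site d) :=
  (anchorsMod M Q r).biUnion fun x => interiorOf R (translate x (cube d M))

theorem tiled_subset (M R : ℕ) (Q : Finset (Site d)) (r : Fin d → ZMod M) :
    tiled M R Q r ⊆ Q :=
  Finset.biUnion_subset.2 fun _ hx => (interiorOf_subset _ _).trans
    (mem_anchors.1 (mem_anchorsMod.1 hx).1).2

theorem disjoint_of_mem_anchorsMod {M : ℕ} {Q : Finset (Site d)} {r : Fin d → ZMod M}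
    {x y : Site d} (hx : x ∈ anchorsMod M Q r) (hy : y ∈ anchorsMod M Q r) (hne : x ≠ y) :
    Disjoint (translate x (cube d M)) (translate y (cube d M)) :=
  disjoint_translate_cube ((mem_anchorsMod.1 hx).2.trans (mem_anchorsMod.1 hy).2.symm) hne

theorem card_anchorsMod_mul_le (M : ℕ) (Q : Finset (Site d)) (r : Fin d → ZMod M) :
    (anchorsMod M Q r).card * M ^ d ≤ Q.card := by
  calc (anchorsMod M Q r).card * M ^ d
      = ∑ x ∈ anchorsMod M Q r, (translate x (cube d M)).card := by
        simp [card_translate_cube]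
    _ = ((anchorsMod M Q r).biUnion fun x => translate x (cube d M)).card :=
        (Finset.card_biUnion fun x hx y hy => disjoint_of_mem_anchorsMod hx hy).symm
    _ ≤ Q.card := Finset.card_le_card <| Finset.biUnion_subset.2 fun _ hx =>
        (mem_anchors.1 (mem_anchorsMod.1 hx).1).2

/-- The grid cube through a site of the `M`-interior stays within distance `M` of it, hence inside
`Q`; only the other sites can be missed. -/
theorem card_le_add_card_anchorsMod {M : ℕ} [NeZero M] (Q : Finset (Site d))
    (r : Fin d → ZMod M) :
    Q.card ≤ (Q \ interiorOf M Q).card + (anchorsMod M Q r).card * M ^ d := by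
  have hsub : Q ⊆ (Q \ interiorOf M Q) ∪
      (anchorsMod M Q r).biUnion fun x => translate x (cube d M) := by
    intro z hz
    by_cases hzi : z ∈ interiorOf M Q
    · obtain ⟨x, hxr, hzx⟩ := exists_residue_mem_translate_cube r z
      have hx : translate x (cube d M) ⊆ Q :=
        (translate_cube_subset_cubeAt hzx).trans (mem_interiorOf.1 hzi)
      have hxx : x ∈ translate x (cube d M) :=
        mem_translate_cube.2 fun i => ⟨le_rfl, by have := Nat.pos_of_neZero M; omega⟩
      exact Finset.mem_union_right _ (Finset.mem_biUnion.2
        ⟨x, mem_anchorsMod.2 ⟨mem_anchors.2 ⟨hx hxx, hx⟩, hxr⟩, hzx⟩)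
    · exact Finset.mem_union_left _ (Finset.mem_sdiff.2 ⟨hz, hzi⟩)
  refine (Finset.card_le_card hsub).trans ((Finset.card_union_le _ _).trans ?_)
  gcongr
  exact Finset.card_biUnion_le_card_mul _ _ _ fun x _ => (card_translate_cube M x).le

theorem card_anchorsMod_mul_le_card_tiled (M R : ℕ) (Q : Finset (Site d))
    (r : Fin d → ZMod M) :
    (anchorsMod M Q r).card * (M - 2 * R) ^ d ≤ (tiled M R Q r).card := by
  rw [tiled, Finset.card_biUnion fun x hx y hy hne =>
    (disjoint_of_mem_anchorsMod hx hy hne).mono (interiorOf_subset _ _) (interiorOf_subset _ _),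
    ← smul_eq_mul]
  exact Finset.card_nsmul_le_sum _ _ _ fun x _ => card_interiorOf_translate_cube_ge M R x

/-- The fraction of a cube of side `M` that is lost by passing to the interior. -/
noncomputable def cubeDefect (d M R : ℕ) : ℝ := 1 - (((M - 2 * R : ℕ) : ℝ) / M) ^ d

theorem tendsto_cubeDefect (d R : ℕ) : Tendsto (fun M => cubeDefect d M R) atTop (𝓝 0) := by
  have h : Tendsto (fun M : ℕ => ((M - 2 * R : ℕ) : ℝ) / M) atTop (𝓝 1) := by
    have h₁ : Tendsto (fun M : ℕ => 1 - (2 * R : ℝ) / M) atTop (𝓝 (1 - 0)) :=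
      tendsto_const_nhds.sub (tendsto_const_div_atTop_nhds_zero_nat _)
    rw [sub_zero] at h₁
    refine h₁.congr' ?_
    filter_upwards [eventually_ge_atTop (2 * R), eventually_gt_atTop 0] with M hM hM0
    rw [Nat.cast_sub hM]
    have : (M : ℝ) ≠ 0 := by positivity
    push_cast
    field_simp
  have := (tendsto_const_nhds (x := (1 : ℝ))).sub (h.pow d)
  simpa [cubeDefect] using this

/-- The boundary term counts sites outside all tiles; `cubeDefect` bounds the share lost when the
tiles shrink. -/
theorem card_sub_card_tiled_le {M : ℕ} [NeZero M] (R : ℕ) (Q : Finset (Site d))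
    (r : Fin d → ZMod M) :
    (Q.card : ℝ) - (tiled M R Q r).card ≤
      (innerBoundary Q).card * (2 * M + 1) ^ d + Q.card * cubeDefect d M R := by
  have h₁ : (Q.card : ℝ) ≤ (Q \ interiorOf M Q).card + (anchorsMod M Q r).card * M ^ d := by
    exact_mod_cast card_le_add_card_anchorsMod Q r
  have h₂ : ((anchorsMod M Q r).card : ℝ) * M ^ d ≤ Q.card := by
    exact_mod_cast card_anchorsMod_mul_le M Q r
  have h₃ : ((anchorsMod M Q r).card : ℝ) * ((M - 2 * R : ℕ) : ℝ) ^ d ≤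
      (tiled M R Q r).card := by
    exact_mod_cast card_anchorsMod_mul_le_card_tiled M R Q r
  have h₄ : ((Q \ interiorOf M Q).card : ℝ) ≤ (innerBoundary Q).card * (2 * M + 1) ^ d := by
    exact_mod_cast card_sdiff_interiorOf_le M Q
  have hM : (M : ℝ) ≠ 0 := by exact_mod_cast NeZero.ne M
  have hδ : 0 ≤ cubeDefect d M R := by
    rw [cubeDefect, sub_nonneg]
    refine pow_le_one₀ (by positivity) (div_le_one_of_le₀ ?_ (by positivity))
    exact_mod_cast Nat.sub_le _ _
  have h₅ : ((anchorsMod M Q r).card : ℝ) * M ^ d -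
      (anchorsMod M Q r).card * ((M - 2 * R : ℕ) : ℝ) ^ d =
      (anchorsMod M Q r).card * M ^ d * cubeDefect d M R := by
    rw [cubeDefect, div_pow]
    field_simp
  have h₆ := mul_le_mul_of_nonneg_right h₂ hδ
  linarith

variable {𝕜 : Type*} [RCLike 𝕜] {E : Type*} [NormedAddCommGroup E]
    [InnerProductSpace 𝕜 E] [FiniteDimensional 𝕜 E] {H : L2 d E →ₗ[𝕜] L2 d E}

/-- A site within `R` of the interior of one tile belongs to that tile, so finite range decouples
different interiors. -/
theorem eigenvalueCount_tiled (hH : H.IsSymmetric) {R : ℕ}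
    (hfr : ∀ x y : Site d, y ∉ cubeAt R x → block H y x = 0) (M : ℕ) (Q : Finset (Site d))
    (r : Fin d → ZMod M) (t : ℝ) :
    eigenvalueCount (compress_isSymmetric hH (tiled M R Q r)) t =
      ∑ x ∈ anchorsMod M Q r,
        eigenvalueCount (compress_isSymmetric hH (interiorOf R (translate x (cube d M)))) t := by
  refine eigenvalueCount_compress_biUnion hH _ _ (fun x hx y hy hne =>
    (disjoint_of_mem_anchorsMod hx hy hne).mono (interiorOf_subset _ _) (interiorOf_subset _ _))
    (fun x hx y hy hne z hz w hw => hfr z w fun hzw => ?_) t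
  exact Finset.disjoint_left.1 (disjoint_of_mem_anchorsMod hx hy hne)
    (mem_interiorOf.1 hz hzw) (interiorOf_subset _ _ hw)

/-- Frequencies count cubes at every position, not on a single grid. Summing the tiling estimate
over all `M^d` residue classes reaches every anchor once. -/
theorem abs_eigenvalueCount_sub_sum_le (hH : H.IsSymmetric) {R : ℕ}
    (hfr : ∀ x y : Site d, y ∉ cubeAt R x → block H y x = 0) (M : ℕ) [NeZero M]
    (Q : Finset (Site d)) (t : ℝ) :
    |(M : ℝ) ^ d * eigenvalueCount (compress_isSymmetric hH Q) t -
      ∑ x ∈ anchors M Q, (eigenvalueCount (compress_isSymmetric hH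
        (interiorOf R (translate x (cube d M)))) t : ℝ)| ≤
      M ^ d * (Module.finrank 𝕜 E *
        ((innerBoundary Q).card * (2 * M + 1) ^ d + Q.card * cubeDefect d M R)) := by
  classical
  have hcard : (M : ℝ) ^ d = ((Finset.univ : Finset (Fin d → ZMod M)).card : ℝ) := by
    simp [ZMod.card]
  have hsum : ∑ x ∈ anchors M Q, (eigenvalueCount (compress_isSymmetric hH
        (interiorOf R (translate x (cube d M)))) t : ℝ) =
      ∑ r : Fin d → ZMod M, (eigenvalueCount (compress_isSymmetric hH (tiled M R Q r)) t : ℝ) := by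
    rw [← Finset.sum_fiberwise _ (residue M)]
    refine Finset.sum_congr rfl fun r _ => ?_
    rw [eigenvalueCount_tiled hH hfr, Nat.cast_sum]
    refine Finset.sum_congr ?_ fun _ _ => rfl
    ext x
    rw [mem_anchorsMod, Finset.mem_filter]
  rw [hsum, hcard, ← nsmul_eq_mul, ← nsmul_eq_mul, ← Finset.sum_const, ← Finset.sum_const,
    ← Finset.sum_sub_distrib]
  refine (Finset.abs_sum_le_sum_abs _ _).trans (Finset.sum_le_sum fun r _ => ?_)
  have h₁ : (eigenvalueCount (compress_isSymmetric hH (tiled M R Q r)) t : ℝ) ≤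
      eigenvalueCount (compress_isSymmetric hH Q) t := by
    exact_mod_cast eigenvalueCount_compress_mono hH (tiled_subset M R Q r) t
  have h₂ : (eigenvalueCount (compress_isSymmetric hH Q) t : ℝ) +
      (tiled M R Q r).card * Module.finrank 𝕜 E ≤
      eigenvalueCount (compress_isSymmetric hH (tiled M R Q r)) t +
        Q.card * Module.finrank 𝕜 E := by
    exact_mod_cast eigenvalueCount_compress_add_le hH (tiled_subset M R Q r) t
  rw [abs_of_nonneg (sub_nonneg.2 h₁)]
  calc _ ≤ (Module.finrank 𝕜 E : ℝ) * (Q.card - (tiled M R Q r).card) := by linarith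
    _ ≤ _ := by
      gcongr
      exact card_sub_card_tiled_le R Q r

end Tiling

/-! ### Pattern classes and occurrence numbers -/

section Frequencies

variable {d : ℕ} {A : Type*} {Γ : Subgroup (Equiv.Perm (Site d))}

variable (Γ A) in
/-- Equivalence of the patterns on a cube. -/
def cubeSetoid (M : ℕ) : Setoid (cube d M → A) where
  r f g := Pattern.Equivalent Γ ⟨cube d M, f⟩ ⟨cube d M, g⟩
  iseqv := (Pattern.equivalent_equivalence Γ).comap (fun f => (⟨cube d M, f⟩ : Pattern d A))

variable (Γ) in
/-- The class of the pattern that a colouring shows in the cube of side `M` at `x`. -/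
def patternClass (Λ : Site d → A) (M : ℕ) (x : Site d) : Quotient (cubeSetoid A Γ M) :=
  Quotient.mk _ fun z => Λ (x + z)

theorem equivalent_cube_translate (hΓ : translationGroup d ≤ Γ) (Λ : Site d → A) (M : ℕ)
    (x : Site d) :
    Pattern.Equivalent Γ ⟨cube d M, fun z => Λ (x + z)⟩
      (colouringRestrict Λ (translate x (cube d M))) := by
  refine ⟨Equiv.addLeft x, hΓ ⟨x, fun y => rfl⟩, ?_⟩
  rw [Pattern.ext_iff']
  refine ⟨rfl, fun z hz => ?_⟩
  obtain ⟨y, hy, rfl⟩ := Finset.mem_map.1 hz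
  simp [Pattern.shift, colouringRestrict]

theorem patternClass_eq_mk_iff (hΓ : translationGroup d ≤ Γ) {Λ : Site d → A} {M : ℕ}
    {x : Site d} {f : cube d M → A} :
    patternClass Γ Λ M x = Quotient.mk _ f ↔
      (colouringRestrict Λ (translate x (cube d M))).Equivalent Γ ⟨cube d M, f⟩ := by
  have he := Pattern.equivalent_equivalence (A := A) Γ
  have ht := equivalent_cube_translate hΓ Λ M x
  rw [patternClass, Quotient.eq]
  exact ⟨fun h => he.trans (he.symm ht) h, fun h => he.trans ht h⟩

theorem equivalent_of_patternClass_eq (hΓ : translationGroup d ≤ Γ) {Λ : Site d → A} {M : ℕ}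
    {x y : Site d} (h : patternClass Γ Λ M x = patternClass Γ Λ M y) :
    (colouringRestrict Λ (translate x (cube d M))).Equivalent Γ
      (colouringRestrict Λ (translate y (cube d M))) :=
  (Pattern.equivalent_equivalence Γ).trans ((patternClass_eq_mk_iff hΓ).1 h)
    (equivalent_cube_translate hΓ Λ M y)

open Classical in
theorem occurrences_eq_card (hΓ : translationGroup d ≤ Γ) (Λ : Site d → A) (M : ℕ)
    (Q : Finset (Site d)) (f : cube d M → A) :
    occurrences Γ ⟨cube d M, f⟩ (colouringRestrict Λ Q) =
      ((anchors M Q).filter fun x => patternClass Γ Λ M x = Quotient.mk _ f).card := by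
  rw [← Set.ncard_coe_finset, occurrences]
  congr 1
  ext x
  rw [Finset.mem_coe, Finset.mem_filter, mem_anchors, patternClass_eq_mk_iff hΓ, and_assoc]
  refine and_congr_right fun _ => ?_
  exact ⟨fun ⟨h, h'⟩ => ⟨h, h'⟩, fun ⟨h, h'⟩ => ⟨h, h'⟩⟩

end Frequencies

/-! ### Uniform limits of distribution functions -/

section UniformLimits

/-- A real-valued sequence of functions that is, up to any `ε`, eventually uniformly close to a
fixed function converges uniformly. -/
theorem exists_tendstoUniformly_of_approx {α : Type*} {g : ℕ → α → ℝ}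
    (h : ∀ ε > 0, ∃ a : α → ℝ, ∀ᶠ j in atTop, ∀ t, |g j t - a t| ≤ ε) :
    ∃ G : α → ℝ, TendstoUniformly g G atTop := by
  have hC : UniformCauchySeqOn g atTop Set.univ := by
    rw [Metric.uniformCauchySeqOn_iff]
    intro ε hε
    obtain ⟨a, ha⟩ := h (ε / 3) (by positivity)
    obtain ⟨J, hJ⟩ := eventually_atTop.1 ha
    refine ⟨J, fun m hm n hn t _ => ?_⟩
    have h₁ := abs_le.1 (hJ m hm t)
    have h₂ := abs_le.1 (hJ n hn t)
    rw [Real.dist_eq, abs_lt]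
    constructor <;> linarith
  have hlim : ∀ t, ∃ y, Tendsto (fun j => g j t) atTop (𝓝 y) := fun t =>
    cauchySeq_tendsto_of_complete (hC.cauchySeq (Set.mem_univ t))
  choose G hG using hlim
  exact ⟨G, tendstoUniformlyOn_univ.1
    (hC.tendstoUniformlyOn_of_tendsto fun t _ => hG t)⟩

theorem tendsto_of_tendstoUniformly_of_eventually {α : Type*} {l : Filter α} {g : ℕ → α → ℝ}
    {G : α → ℝ} {c : ℝ} (hg : TendstoUniformly g G atTop)
    (h : ∀ᶠ j in atTop, Tendsto (g j) l (𝓝 c)) : Tendsto G l (𝓝 c) := by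
  rw [Metric.tendsto_nhds]
  intro ε hε
  obtain ⟨j, hj, hj'⟩ :=
    ((Metric.tendstoUniformly_iff.1 hg (ε / 2) (by positivity)).and h).exists
  filter_upwards [Metric.tendsto_nhds.1 hj' (ε / 2) (by positivity)] with t ht
  calc dist (G t) c ≤ dist (G t) (g j t) + dist (g j t) c := dist_triangle _ _ _
    _ < ε := by linarith [hj t]

theorem continuousWithinAt_Ici_of_tendstoUniformly {g : ℕ → ℝ → ℝ} {G : ℝ → ℝ}
    (hg : TendstoUniformly g G atTop) (h : ∀ j t, ContinuousWithinAt (g j) (Set.Ici t) t)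
    (t : ℝ) : ContinuousWithinAt G (Set.Ici t) t := by
  rw [Metric.continuousWithinAt_iff']
  intro ε hε
  obtain ⟨j, hj⟩ := (Metric.tendstoUniformly_iff.1 hg (ε / 3) (by positivity)).exists
  filter_upwards [Metric.continuousWithinAt_iff'.1 (h j t) (ε / 3) (by positivity)] with s hs
  have h₁ := hj s
  have h₂ := hj t
  rw [dist_comm] at h₂
  calc dist (G s) (G t) ≤ dist (G s) (g j s) + dist (g j s) (g j t) + dist (g j t) (G t) :=
        dist_triangle4 _ _ _ _
    _ < ε := by linarith

/-- A uniform limit of distribution functions is the distribution function of a unique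
probability measure. -/
theorem existsUnique_measure_of_tendstoUniformly {g : ℕ → ℝ → ℝ} {G : ℝ → ℝ}
    (hg : TendstoUniformly g G atTop) (hmono : ∀ j, Monotone (g j))
    (hcont : ∀ j t, ContinuousWithinAt (g j) (Set.Ici t) t)
    (hbot : ∀ᶠ j in atTop, Tendsto (g j) atBot (𝓝 0))
    (htop : ∀ᶠ j in atTop, Tendsto (g j) atTop (𝓝 1)) :
    ∃! μ : Measure ℝ, IsProbabilityMeasure μ ∧
      TendstoUniformly g (fun t => μ.real (Set.Iic t)) atTop := by
  have hGmono : Monotone G := fun s t hst =>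
    le_of_tendsto_of_tendsto' (hg.tendsto_at s) (hg.tendsto_at t) fun j => hmono j hst
  have hGbot := tendsto_of_tendstoUniformly_of_eventually hg hbot
  have hGtop := tendsto_of_tendstoUniformly_of_eventually hg htop
  let F : StieltjesFunction ℝ :=
    { toFun := G
      mono' := hGmono
      right_continuous' := continuousWithinAt_Ici_of_tendstoUniformly hg hcont }
  have hF : ∀ t, F.measure.real (Set.Iic t) = G t := by
    intro t
    rw [measureReal_def, F.measure_Iic hGbot, sub_zero,
      ENNReal.toReal_ofReal (hGmono.le_of_tendsto hGbot t)]
  refine ⟨F.measure, ⟨F.isProbabilityMeasure hGbot hGtop, ?_⟩, ?_⟩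
  · simpa only [hF] using hg
  · rintro ν ⟨hν, hgν⟩
    have := F.isProbabilityMeasure hGbot hGtop
    refine Measure.ext_of_Iic _ _ fun t => ?_
    rw [← measureReal_eq_measureReal_iff, hF]
    exact tendsto_nhds_unique (hgν.tendsto_at t) (hg.tendsto_at t)

end UniformLimits

/-! ### Uniform convergence of the normalized counts -/

section Main

variable {𝕜 : Type*} [RCLike 𝕜] {d : ℕ} {A : Type*} {E : Type*} [NormedAddCommGroup E]
  [InnerProductSpace 𝕜 E] [FiniteDimensional 𝕜 E] {H : L2 d E →ₗ[𝕜] L2 d E}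

/-- The mean over `Q` of a bounded function of the cube patterns converges uniformly. -/
theorem exists_eventually_abs_sum_anchors_sub_le [Finite A]
    {Γ : Subgroup (Equiv.Perm (Site d))} (hΓ : translationGroup d ≤ Γ) {Λ : Site d → A}
    {Q : ℕ → Finset (Site d)} (hν : FrequenciesExist Γ Λ Q) (M : ℕ)
    {φ : Site d → ℝ → ℝ} {B : ℝ} (hB : ∀ x t, |φ x t| ≤ B)
    (hφ : ∀ x y, patternClass Γ Λ M x = patternClass Γ Λ M y → φ x = φ y)
    {ε : ℝ} (hε : 0 < ε) :
    ∃ a : ℝ → ℝ, ∀ᶠ j in atTop, ∀ t,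
      |(∑ x ∈ anchors M (Q j), φ x t) / (Q j).card - a t| ≤ ε := by
  classical
  have : Fintype (Quotient (cubeSetoid A Γ M)) := Fintype.ofFinite _
  -- `φ` factors through the pattern class; classes that `Λ` never shows get the default `0`.
  let ψ : Quotient (cubeSetoid A Γ M) → ℝ → ℝ := fun q =>
    if h : ∃ x, patternClass Γ Λ M x = q then φ h.choose else 0
  have hψ : ∀ x, φ x = ψ (patternClass Γ Λ M x) := fun x => by
    have h : ∃ y, patternClass Γ Λ M y = patternClass Γ Λ M x := ⟨x, rfl⟩
    rw [show ψ (patternClass Γ Λ M x) = φ h.choose from dif_pos h]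
    exact hφ _ _ h.choose_spec.symm
  have hB0 : 0 ≤ B := (abs_nonneg _).trans (hB 0 0)
  have hψB : ∀ q t, |ψ q t| ≤ B := fun q t => by
    by_cases h : ∃ x, patternClass Γ Λ M x = q
    · obtain ⟨x, rfl⟩ := h
      rw [← hψ]
      exact hB x t
    · rw [show ψ q = 0 from dif_neg h]
      simpa using hB0
  let c : Quotient (cubeSetoid A Γ M) → ℕ → ℝ := fun q j =>
    (((anchors M (Q j)).filter fun x => patternClass Γ Λ M x = q).card : ℝ) / (Q j).card
  have hc : ∀ q, ∃ ν, Tendsto (c q) atTop (𝓝 ν) := by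
    intro q
    induction q using Quotient.inductionOn with
    | h f =>
      obtain ⟨ν, h⟩ := hν M ⟨cube d M, f⟩ rfl
      refine ⟨ν, h.congr fun j => ?_⟩
      rw [occurrences_eq_card hΓ]
  choose ν hν using hc
  refine ⟨fun t => ∑ q, ν q * ψ q t, ?_⟩
  have hsum : ∀ j t, (∑ x ∈ anchors M (Q j), φ x t) / (Q j).card = ∑ q, c q j * ψ q t := by
    intro j t
    rw [← Finset.sum_fiberwise _ (patternClass Γ Λ M), Finset.sum_div]
    refine Finset.sum_congr rfl fun q _ => ?_
    rw [Finset.sum_congr rfl (g := fun _ => ψ q t) fun x hx => by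
      rw [hψ, (Finset.mem_filter.1 hx).2], Finset.sum_const, nsmul_eq_mul]
    simp only [c]
    ring
  -- There are finitely many classes and `t` enters only through the bounded `ψ`, so this bound is
  -- uniform in `t`.
  have hlim : Tendsto (fun j => (∑ q, |c q j - ν q|) * B) atTop (𝓝 0) := by
    have : Tendsto (fun j => ∑ q, |c q j - ν q|) atTop
        (𝓝 (∑ _q : Quotient (cubeSetoid A Γ M), (0 : ℝ))) :=
      tendsto_finsetSum _ fun q _ => by
        simpa using ((hν q).sub_const (ν q)).abs
    simpa using this.mul_const B
  filter_upwards [hlim.eventually_le_const hε] with j hj t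
  refine le_trans ?_ hj
  rw [hsum, ← Finset.sum_sub_distrib, Finset.sum_mul]
  refine (Finset.abs_sum_le_sum_abs _ _).trans (Finset.sum_le_sum fun q _ => ?_)
  rw [← sub_mul, abs_mul]
  exact mul_le_mul_of_nonneg_left (hψB q t) (abs_nonneg _)

theorem exists_eventually_abs_normalized_sub_le [Finite A] [Nontrivial E]
    {Γ : Subgroup (Equiv.Perm (Site d))} (hΓ : translationGroup d ≤ Γ)
    (hΓ' : Γ ≤ automorphismGroup d) {Λ : Site d → A}
    {Q : ℕ → Finset (Site d)} (hQ : IsVanHove Q) (hν : FrequenciesExist Γ Λ Q)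
    (hH : H.IsSymmetric) (hinv : ColouringInvariant Γ Λ H) (hfr : FiniteRange H)
    {ε : ℝ} (hε : 0 < ε) :
    ∃ a : ℝ → ℝ, ∀ᶠ j in atTop, ∀ t,
      |(eigenvalueCount (compress_isSymmetric hH (Q j)) t : ℝ) /
        ((Q j).card * (Module.finrank 𝕜 E : ℝ)) - a t| ≤ ε := by
  obtain ⟨R₀, hinv⟩ := hinv
  obtain ⟨R₁, -, hfr⟩ := hfr
  set R := max R₀ ⌈R₁⌉₊ with hR
  have hfr' : ∀ x y : Site d, y ∉ cubeAt R x → block H y x = 0 := by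
    intro x y hy
    refine hfr x y ?_
    by_contra! hle
    refine hy (mem_cubeAt.2 fun i => ?_)
    have h₁ : dist (x i) (y i) ≤ R := (dist_le_pi_dist x y i).trans
      (hle.trans ((Nat.le_ceil R₁).trans (by exact_mod_cast le_max_right _ _)))
    rw [Int.dist_eq, abs_sub_comm] at h₁
    exact_mod_cast h₁
  -- `M` is fixed before `j` grows: the defect depends only on `M`, while the boundary error
  -- vanishes for each fixed `M`.
  obtain ⟨M, hMδ, hM0⟩ := (((tendsto_cubeDefect d R).eventually_le_const
    (show 0 < ε / 3 by positivity)).and (eventually_gt_atTop 0)).exists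
  have : NeZero M := ⟨hM0.ne'⟩
  set N : ℝ := (Module.finrank 𝕜 E : ℝ) with hN
  have hN0 : 0 < N := by
    rw [hN]
    exact_mod_cast Module.finrank_pos
  have hK0 : 0 < (M : ℝ) ^ d * N := by positivity
  obtain ⟨a, ha⟩ := exists_eventually_abs_sum_anchors_sub_le hΓ hν M
    (φ := fun x t => (eigenvalueCount (compress_isSymmetric hH
      (interiorOf R (translate x (cube d M)))) t : ℝ)) (B := M ^ d * N)
    (fun x t => by
      rw [Nat.abs_cast]
      have := eigenvalueCount_le_finrank (compress_isSymmetric hH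
        (interiorOf R (translate x (cube d M)))) t
      rw [finrank_supportedIn] at this
      refine (Nat.cast_le.2 this).trans ?_
      rw [Nat.cast_mul, hN]
      gcongr
      have h := Finset.card_le_card (interiorOf_subset R (translate x (cube d M)))
      rw [card_translate_cube] at h
      exact_mod_cast h)
    (fun x y hxy => by
      ext t
      exact_mod_cast eigenvalueCount_interiorOf_eq hΓ' hH (le_max_left _ _) hinv
        (equivalent_of_patternClass_eq hΓ hxy) t)
    (show 0 < ε / 3 * (M ^ d * N) by positivity)
  have hb : Tendsto (fun j => ((innerBoundary (Q j)).card : ℝ) / (Q j).card *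
      (2 * M + 1) ^ d) atTop (𝓝 0) := by
    simpa using hQ.2.mul_const (((2 : ℝ) * M + 1) ^ d)
  refine ⟨fun t => a t / (M ^ d * N), ?_⟩
  filter_upwards [ha, hQ.1, hb.eventually_le_const (show 0 < ε / 3 by positivity)]
    with j hj hne hbj t
  have hq : 0 < ((Q j).card : ℝ) := by exact_mod_cast hne.card_pos
  have h₁ := abs_eigenvalueCount_sub_sum_le hH hfr' M (Q j) t
  have h₂ := hj t
  set S : ℝ := ∑ x ∈ anchors M (Q j), (eigenvalueCount (compress_isSymmetric hH
    (interiorOf R (translate x (cube d M)))) t : ℝ)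
  set n : ℝ := (eigenvalueCount (compress_isSymmetric hH (Q j)) t : ℝ)
  set b : ℝ := ((innerBoundary (Q j)).card : ℝ)
  set q : ℝ := ((Q j).card : ℝ)
  -- The first term is the tiling error, the second the error of the frequencies, rescaled by `M ^ d
  -- * N`.
  have e₁ : n / (q * N) - a t / (M ^ d * N) =
      (M ^ d * n - S) / (q * (M ^ d * N)) + (S / q - a t) / (M ^ d * N) := by
    field_simp
    ring
  have b₁ : |(M ^ d * n - S) / (q * (M ^ d * N))| ≤ ε / 3 + ε / 3 := by
    rw [abs_div, abs_of_pos (show 0 < q * (M ^ d * N) by positivity),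
      div_le_iff₀ (by positivity)]
    refine h₁.trans ?_
    have h₃ : b * (2 * M + 1) ^ d ≤ ε / 3 * q := by
      rwa [div_mul_eq_mul_div, div_le_iff₀ hq] at hbj
    have h₄ : q * cubeDefect d M R ≤ ε / 3 * q := by
      rw [mul_comm]
      gcongr
    calc (M : ℝ) ^ d * (N * (b * (2 * M + 1) ^ d + q * cubeDefect d M R))
        ≤ (M : ℝ) ^ d * (N * (ε / 3 * q + ε / 3 * q)) := by gcongr
      _ = (ε / 3 + ε / 3) * (q * (M ^ d * N)) := by ring
  have b₂ : |(S / q - a t) / (M ^ d * N)| ≤ ε / 3 := by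
    rwa [abs_div, abs_of_pos hK0, div_le_iff₀ hK0]
  rw [e₁]
  exact (abs_add_le _ _).trans (by linarith)

end Main

end LatticeIDS

theorem mainTheorem2 {𝕜 : Type*} [RCLike 𝕜] (d : ℕ) {A : Type*} [Finite A]
    {E : Type*} [NormedAddCommGroup E] [InnerProductSpace 𝕜 E] [FiniteDimensional 𝕜 E]
    [Nontrivial E]
    (Γ : Subgroup (Equiv.Perm (LatticeIDS.Site d)))
    (hΓ : Γ = LatticeIDS.translationGroup d ∨ Γ = LatticeIDS.automorphismGroup d)
    (Λ : LatticeIDS.Site d → A)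
    (Q : ℕ → Finset (LatticeIDS.Site d)) (hQ : LatticeIDS.IsVanHove Q)
    (hν : LatticeIDS.FrequenciesExist Γ Λ Q)
    (H : LatticeIDS.L2 d E →ₗ[𝕜] LatticeIDS.L2 d E)
    -- an everywhere defined symmetric operator, i.e. a selfadjoint one
    (hH : H.IsSymmetric)
    (hinv : LatticeIDS.ColouringInvariant Γ Λ H)
    (hfr : LatticeIDS.FiniteRange H) :
    ∃! μ : Measure ℝ, IsProbabilityMeasure μ ∧
      TendstoUniformly
        (fun (j : ℕ) (t : ℝ) =>
          (LatticeIDS.eigenvalueCount (LatticeIDS.compress_isSymmetric hH (Q j)) t : ℝ) /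
            (((Q j).card : ℝ) * (Module.finrank 𝕜 E : ℝ)))
        (fun t : ℝ => μ.real (Set.Iic t)) atTop := by
  -- Only these inclusions matter: translations compare cubes at different positions, and
  -- automorphisms preserve `cubeAt`.
  have hT : LatticeIDS.translationGroup d ≤ Γ ∧ Γ ≤ LatticeIDS.automorphismGroup d := by
    rcases hΓ with rfl | rfl
    · exact ⟨le_rfl, LatticeIDS.translationGroup_le_automorphismGroup⟩
    · exact ⟨LatticeIDS.translationGroup_le_automorphismGroup, le_rfl⟩
  obtain ⟨G, hG⟩ := LatticeIDS.exists_tendstoUniformly_of_approx fun ε hε =>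
    LatticeIDS.exists_eventually_abs_normalized_sub_le hT.1 hT.2 hQ hν hH hinv hfr hε
  refine LatticeIDS.existsUnique_measure_of_tendstoUniformly hG ?_ ?_ ?_ ?_
  · intro j s t hst
    dsimp only
    gcongr
    exact LatticeIDS.eigenvalueCount_mono _ hst
  · intro j t
    refine ContinuousWithinAt.div_const ?_ _
    refine tendsto_nhds_of_eventually_eq ?_
    filter_upwards [LatticeIDS.eventually_eigenvalueCount_eq
      (LatticeIDS.compress_isSymmetric hH (Q j)) t] with s hs
    rw [hs]
  · refine Eventually.of_forall fun j => tendsto_nhds_of_eventually_eq ?_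
    filter_upwards [LatticeIDS.eventually_eigenvalueCount_eq_zero
      (LatticeIDS.compress_isSymmetric hH (Q j))] with s hs
    rw [hs, Nat.cast_zero, zero_div]
  -- For empty `Q j` the quotient is `0 / 0 = 0`, so the limit `1` at `+∞` needs nonemptiness.
  · filter_upwards [hQ.1] with j hj
    refine tendsto_nhds_of_eventually_eq ?_
    filter_upwards [LatticeIDS.eventually_eigenvalueCount_eq_finrank
      (LatticeIDS.compress_isSymmetric hH (Q j))] with s hs
    rw [hs, LatticeIDS.finrank_supportedIn, Nat.cast_mul]
    have h₁ : ((Q j).card : ℝ) ≠ 0 := by exact_mod_cast hj.card_pos.ne'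
    have h₂ : (Module.finrank 𝕜 E : ℝ) ≠ 0 := by exact_mod_cast Module.finrank_pos.ne'
    exact div_self (mul_ne_zero h₁ h₂)
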